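/- Notation: $[n]=\{0,1,\dots,n-1\}$. For an abelian group $G$ and $S\subseteq G\setminus\{0\}$, $\mathrm{Cay}(G,S)$ is the directed graph on $G$ with an arc from $x$ to $y$ if and only if $y-x\in S$, and $S_0=S\cup\{0\}$. A set $C\subseteq G$ is a perfect code in $\mathrm{Cay}(G,S)$ if for every $v\in G$ there is exactly one $u\in C$ such that $u=v$ or there is an arc from $u$ to $v$. **Theorem.** Let $G=\mathbb{Z}_{p^k}\times\mathbb{Z}_q$ for distinct primes $p,q$ and a positive integer $k$. Let $S$ be a proper subset of $G\setminus\{0\}$ that generates $G$, and let $0\in C\subseteq G$. Then $C$ is a perfect code in $\mathrm{Cay}(G,S)$ if and only if there are integers $n\ge 1$, $r\in[n]$, integers $m_0,\dots,m_n$ with $0=m_0$, $m_n=k$, $m_t<m_{t+1}$ for $t\in[n]\setminus\{r\}$ and $m_r\le m_{r+1}$, integers $l_0,\dots,l_{n-1}$ with $1\le l_t\le m_{t+1}-m_t$ for $t\in[n]\setminus\{r\}$ and $0\le l_r\le m_{r+1}-m_r$, and integers $\alpha_{i_0,\dots,i_t}$, $\alpha_{i_0,\dots,i_t,j}$, $\beta_{i_0,\dots,i_t}$,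 $\beta_{i_0,\dots,i_t,j}$ with $\alpha_{0,\dots,0}=\beta_{0,\dots,0}=0$ (for index tuples of every length; for $r=0$ the symbol $\beta_{i_0,\dots,i_{r-1}}$ means $0$), such that $(S_0,C)$ is one of the following pairs, where moreover $m_r<m_{r+1}$ in (a), (b) and (d): (a) with $m_r+l_r=m_{r+1}$, $$S_0=\Big\{\Big(\sum_{t=0}^{n-1}i_tp^{m_t}+\sum_{t\in[n]\setminus\{r\}}\alpha_{i_0,\dots,i_t}p^{m_t+l_t},\ \alpha_{i_0,\dots,i_r}\Big)\ \Big|\ i_t\in[p^{l_t}]\Big\},$$ $$C=\Big\{\Big(\sum_{t\in[n]\setminus\{r\}}i_tp^{m_t+l_t}+\sum_{t=0}^{n-1}\beta_{i_0,\dots,i_t}p^{m_{t+1}},\ i_r\Big)\ \Big|\ i_t\in[p^{m_{t+1}-m_t-l_t}]\text{ for }t\ne r,\ i_r\in[q]\Big\};$$ (b) $$S_0=\Big\{\Big(\sum_{t=0}^{n-1}\big(i_tp^{m_t}+\alpha_{i_0,\dots,i_t}p^{m_t+l_t}\big),\ \alpha_{i_0,\dots,i_r}\Big)\ \Big|\ i_t\in[p^{l_t}]\Big\},$$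 $$C=\Big\{\Big(\sum_{t=0}^{n-1}i_tp^{m_t+l_t}+\sum_{t=0}^{r-1}\beta_{i_0,\dots,i_t}p^{m_{t+1}}+\sum_{t=r}^{n-1}\beta_{i_0,\dots,i_t,j}\,p^{m_{t+1}},\ j\Big)\ \Big|\ i_t\in[p^{m_{t+1}-m_t-l_t}],\ j\in[q]\Big\};$$ (c) with $l_r=0$, $$S_0=\Big\{\Big(\sum_{t\in[n]\setminus\{r\}}i_tp^{m_t}+\sum_{t=0}^{n-1}\alpha_{i_0,\dots,i_t}p^{m_t+l_t},\ i_r\Big)\ \Big|\ i_t\in[p^{l_t}]\text{ for }t\ne r,\ i_r\in[q]\Big\},$$ $$C=\Big\{\Big(\sum_{t=0}^{n-1}i_tp^{m_t+l_t}+\sum_{t\in[n]\setminus\{r-1\}}\beta_{i_0,\dots,i_t}p^{m_{t+1}},\ \beta_{i_0,\dots,i_{r-1}}\Big)\ \Big|\ i_t\in[p^{m_{t+1}-m_t-l_t}]\Big\};$$ (d) $$S_0=\Big\{\Big(\sum_{t=0}^{n-1}i_tp^{m_t}+\sum_{t=0}^{r-1}\alpha_{i_0,\dots,i_t}p^{m_t+l_t}+\sum_{t=r}^{n-1}\alpha_{i_0,\dots,i_t,j}\,p^{m_t+l_t},\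 j\Big)\ \Big|\ i_t\in[p^{l_t}],\ j\in[q]\Big\},$$ $$C=\Big\{\Big(\sum_{t=0}^{n-1}\big(i_tp^{m_t+l_t}+\beta_{i_0,\dots,i_t}p^{m_{t+1}}\big),\ \beta_{i_0,\dots,i_{r-1}}\Big)\ \Big|\ i_t\in[p^{m_{t+1}-m_t-l_t}]\Big\}.$$ -/

import Mathlib

/-- The Cayley digraph `Cay(G, S)` of an additive group: an arc from `x` to `y` iff `y - x ∈ S`. -/
def cayleyDigraph {G : Type*} [AddGroup G] (S : Set G) : Digraph G where
  Adj x y := y - x ∈ S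

/-- `C` is a perfect code: every vertex `v` is at directed distance at most `1` from exactly one
vertex `u` of `C` (that is, the closed out-neighbourhoods of the members of `C` partition the
vertex set). -/
def Digraph.IsPerfectCode {V : Type*} (Γ : Digraph V) (C : Set V) : Prop :=
  ∀ v : V, ∃! u : V, u ∈ C ∧ (u = v ∨ Γ.Adj u v)

namespace PerfectCode

/-- The tuple `(i_0, …, i_{t-1})` of length `t`. -/
def pre (i : ℕ → ℕ) (t : ℕ) : List ℕ := (List.range t).map i

/-- A family of integers `α_{i_0,…,i_t}` (and `α_{i_0,…,i_t,j}`), indexed by finite tuples of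
natural numbers, is normalized if `α_{0,…,0} = 0` for every tuple of zeros, whatever its length. -/
def Normalized (α : List ℕ → ℤ) : Prop :=
  ∀ L : List ℕ, (∀ x ∈ L, x = 0) → α L = 0

/-- The element `(x mod p ^ k, y mod q)` of `ℤ_{p^k} × ℤ_q`. -/
def elt (p k q : ℕ) (x y : ℤ) : ZMod (p ^ k) × ZMod q := ((x : ZMod (p ^ k)), (y : ZMod q))

/-- The conditions on `n`, `r`, `m_0, …, m_n` and `l_0, …, l_{n-1}` common to the four families:
`r ∈ {0, …, n-1}`, `0 = m_0`, `m_n = k`, `m_t < m_{t+1}` and `1 ≤ l_t ≤ m_{t+1} - m_t` for `t ≠ r`,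
and `m_r ≤ m_{r+1}`, `0 ≤ l_r ≤ m_{r+1} - m_r`. -/
structure Admissible (k n r : ℕ) (m l : ℕ → ℕ) : Prop where
  r_lt : r < n
  m_zero : m 0 = 0
  m_last : m n = k
  m_lt : ∀ t < n, t ≠ r → m t < m (t + 1)
  m_r_le : m r ≤ m (r + 1)
  one_le_l : ∀ t < n, t ≠ r → 1 ≤ l t
  l_le : ∀ t < n, l t ≤ m (t + 1) - m t

section Families

variable (p k q n r : ℕ) (m l : ℕ → ℕ) (α β : List ℕ → ℤ)

/-- The set `S₀` of family (a). -/
def setA : Set (ZMod (p ^ k) × ZMod q) :=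
  {x | ∃ i : ℕ → ℕ, (∀ t < n, i t < p ^ l t) ∧
    x = elt p k q
      ((∑ t ∈ Finset.range n, (i t : ℤ) * (p : ℤ) ^ m t)
        + ∑ t ∈ (Finset.range n).erase r, α (pre i (t + 1)) * (p : ℤ) ^ (m t + l t))
      (α (pre i (r + 1)))}

/-- The code `C` of family (a). -/
def codeA : Set (ZMod (p ^ k) × ZMod q) :=
  {x | ∃ i : ℕ → ℕ, (∀ t < n, t ≠ r → i t < p ^ (m (t + 1) - m t - l t)) ∧ i r < q ∧
    x = elt p k q
      ((∑ t ∈ (Finset.range n).erase r, (i t : ℤ) * (p : ℤ) ^ (m t + l t))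
        + ∑ t ∈ Finset.range n, β (pre i (t + 1)) * (p : ℤ) ^ m (t + 1))
      (i r)}

/-- The set `S₀` of family (b). -/
def setB : Set (ZMod (p ^ k) × ZMod q) :=
  {x | ∃ i : ℕ → ℕ, (∀ t < n, i t < p ^ l t) ∧
    x = elt p k q
      (∑ t ∈ Finset.range n,
        ((i t : ℤ) * (p : ℤ) ^ m t + α (pre i (t + 1)) * (p : ℤ) ^ (m t + l t)))
      (α (pre i (r + 1)))}

/-- The code `C` of family (b); `β (pre i (t + 1) ++ [j])` is `β_{i_0,…,i_t,j}`. -/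
def codeB : Set (ZMod (p ^ k) × ZMod q) :=
  {x | ∃ (i : ℕ → ℕ) (j : ℕ), (∀ t < n, i t < p ^ (m (t + 1) - m t - l t)) ∧ j < q ∧
    x = elt p k q
      ((∑ t ∈ Finset.range n, (i t : ℤ) * (p : ℤ) ^ (m t + l t))
        + (∑ t ∈ Finset.range r, β (pre i (t + 1)) * (p : ℤ) ^ m (t + 1))
        + ∑ t ∈ Finset.Ico r n, β (pre i (t + 1) ++ [j]) * (p : ℤ) ^ m (t + 1))
      j}

/-- The set `S₀` of family (c). -/
def setC : Set (ZMod (p ^ k) × ZMod q) :=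
  {x | ∃ i : ℕ → ℕ, (∀ t < n, t ≠ r → i t < p ^ l t) ∧ i r < q ∧
    x = elt p k q
      ((∑ t ∈ (Finset.range n).erase r, (i t : ℤ) * (p : ℤ) ^ m t)
        + ∑ t ∈ Finset.range n, α (pre i (t + 1)) * (p : ℤ) ^ (m t + l t))
      (i r)}

/-- The code `C` of family (c). The filter removes the index `t = r - 1`, hence nothing if `r = 0`;
`β (pre i r)` is `β_{i_0,…,i_{r-1}}`. -/
def codeC : Set (ZMod (p ^ k) × ZMod q) :=
  {x | ∃ i : ℕ → ℕ, (∀ t < n, i t < p ^ (m (t + 1) - m t - l t)) ∧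
    x = elt p k q
      ((∑ t ∈ Finset.range n, (i t : ℤ) * (p : ℤ) ^ (m t + l t))
        + ∑ t ∈ (Finset.range n).filter (fun t => t + 1 ≠ r),
            β (pre i (t + 1)) * (p : ℤ) ^ m (t + 1))
      (β (pre i r))}

/-- The set `S₀` of family (d); `α (pre i (t + 1) ++ [j])` is `α_{i_0,…,i_t,j}`. -/
def setD : Set (ZMod (p ^ k) × ZMod q) :=
  {x | ∃ (i : ℕ → ℕ) (j : ℕ), (∀ t < n, i t < p ^ l t) ∧ j < q ∧
    x = elt p k q
      ((∑ t ∈ Finset.range n, (i t : ℤ) * (p : ℤ) ^ m t)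
        + (∑ t ∈ Finset.range r, α (pre i (t + 1)) * (p : ℤ) ^ (m t + l t))
        + ∑ t ∈ Finset.Ico r n, α (pre i (t + 1) ++ [j]) * (p : ℤ) ^ (m t + l t))
      j}

/-- The code `C` of family (d). -/
def codeD : Set (ZMod (p ^ k) × ZMod q) :=
  {x | ∃ i : ℕ → ℕ, (∀ t < n, i t < p ^ (m (t + 1) - m t - l t)) ∧
    x = elt p k q
      (∑ t ∈ Finset.range n,
        ((i t : ℤ) * (p : ℤ) ^ (m t + l t) + β (pre i (t + 1)) * (p : ℤ) ^ m (t + 1)))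
      (β (pre i r))}

end Families

end PerfectCode

/-! A set `C` is a perfect code exactly when `G = S₀ + C` is a tiling
(`isPerfectCode_cayleyDigraph_iff`), so the theorem classifies tilings of `ℤ/p^k × ℤ/q`.

A faithful character of the cyclic group `G` kills the sum of all elements, hence kills one factor.
Elements of the group ring are polynomials in a generator, so the polynomial of that factor is
divisible by `Φ_N` (`aeval_mul_setSum_eq_zero`). For `N = p^(k+1)` this makes the factor periodic
under `p^k`. For `N = p^(k+1) * q` it says only that the difference of its indicator in direction
`p^k` does not depend on the `ℤ/q`-coordinate. The missing information comes from a second tiling: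
if `q` does not divide `|B|`, then `B` may be replaced by its projection to `ℤ/p^k`
(`flatten_right`), so every layer of `A` tiles with that projection. Together these show that one
factor has period `p^k` or that `A` is a union of cosets of `ℤ/q` (`periodic_trichotomy`). Passing
to the quotient and inducting gives `IsDigitTiling`: with coordinates taken to be the base-`p`
digits and the `ℤ/q`-coordinate inserted at some position `j`, each coordinate is determined by
earlier ones in one of the two factors.

All four families are tilings, since their parameters can be recovered successively
(`triangular_elimination`) and their number is right; this is the converse implication. For the
forward one, the digit structure places `S₀` and `C` inside the two sets of family (b) or (c),
according to the factor in which the `ℤ/q`-coordinate is determined, and a tiling contained in a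
tiling equals it (`eq_of_subset`). Families (b) and (c), with free blocks of length at most one,
thus already cover every tiling. -/

/-! ### Tilings as product identities in the group ring. -/

section GroupRing

open AddMonoidAlgebra

variable {G : Type*} [AddCommGroup G] [Finite G]

/-- The element `∑_{a ∈ A} a` of the group ring `R[G]`. -/
noncomputable def setSum (R : Type*) [CommRing R] (A : Set G) : AddMonoidAlgebra R G :=
  ∑ a ∈ A.toFinite.toFinset, single a 1

omit [AddCommGroup G] in
theorem coeff_setSum (R : Type*) [CommRing R] (A : Set G) [DecidablePred (· ∈ A)] (g : G) :
    (setSum R A).coeff g = if g ∈ A then 1 else 0 := by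
  classical
  simp [setSum, Finsupp.single_apply]

theorem setSum_mul_setSum (R : Type*) [CommRing R] {A B : Set G}
    (h : AddSubgroup.IsComplement A B) : setSum R A * setSum R B = setSum R Set.univ := by
  classical
  rw [setSum, setSum, setSum, Finset.sum_mul_sum, ← Finset.sum_product']
  refine Finset.sum_bij (fun x _ => x.1 + x.2) (by simp) ?_ ?_ ?_
  · rintro ⟨a, b⟩ hab ⟨a', b'⟩ hab' heq
    simp only [Finset.mem_product, Set.Finite.mem_toFinset] at hab hab'
    have := @h.1 (⟨a, hab.1⟩, ⟨b, hab.2⟩) (⟨a', hab'.1⟩, ⟨b', hab'.2⟩) heq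
    simpa using this
  · intro g _
    obtain ⟨⟨a, b⟩, hab⟩ := h.2 g
    exact ⟨(a, b), by simp, hab⟩
  · rintro ⟨a, b⟩ _
    simp [single_mul_single]

theorem single_mul_setSum_univ (R : Type*) [CommRing R] (g : G) :
    single g 1 * setSum R (Set.univ : Set G) = setSum R Set.univ := by
  classical
  ext x
  simp [coeff_setSum]

theorem setSum_univ_mul_setSum (R : Type*) [CommRing R] (B : Set G) :
    setSum R (Set.univ : Set G) * setSum R B = (Nat.card B : R) • setSum R Set.univ := by
  rw [mul_comm, setSum, Finset.sum_mul]
  simp [single_mul_setSum_univ, Nat.card_coe_set_eq, Set.ncard_eq_toFinset_card B,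
    ← Nat.cast_smul_eq_nsmul R]

/-- In a tiling `G = A + B`, the set `B` may be replaced by `q ^ e • B` for a prime `q` not dividing
`|B|`. -/
theorem AddSubgroup.IsComplement.exists_add_pow_nsmul {A B : Set G}
    (h : AddSubgroup.IsComplement A B) {q : ℕ} (hq : q.Prime) (hB : ¬ q ∣ Nat.card B) (e : ℕ)
    (g : G) : ∃ a ∈ A, ∃ b ∈ B, a + q ^ e • b = g := by
  classical
  by_contra! hne
  have : Fact q.Prime := ⟨hq⟩
  have : CharP (AddMonoidAlgebra (ZMod q) G) q := charP_of_injective_algebraMap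
    (R := ZMod q) (FaithfulSMul.algebraMap_injective _ _) q
  -- Frobenius: in characteristic `q` the power is taken term by term.
  have hpow : setSum (ZMod q) B ^ (q ^ e) =
      ∑ b ∈ B.toFinite.toFinset, single (q ^ e • b) (1 : ZMod q) := by
    rw [setSum, sum_pow_char_pow]
    simp
  -- The first factor `B` turns `A` into the sum of `G`, and each further one multiplies by `|B|`, a
  -- unit modulo `q`. So no coefficient of the product vanishes.
  have hiter : ∀ n : ℕ, setSum (ZMod q) A * setSum (ZMod q) B ^ (n + 1) =
      (Nat.card B : ZMod q) ^ n • setSum (ZMod q) Set.univ := by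
    intro n
    induction n with
    | zero => simp [setSum_mul_setSum _ h]
    | succ n ih =>
      rw [pow_succ, ← mul_assoc, ih, smul_mul_assoc, setSum_univ_mul_setSum, smul_smul, pow_succ]
  obtain ⟨n, hn⟩ : ∃ n, q ^ e = n + 1 := Nat.exists_eq_succ_of_ne_zero (pow_pos hq.pos e).ne'
  have h1 := hiter n
  rw [← hn, hpow, setSum, Finset.sum_mul_sum] at h1
  have h2 := congrArg (fun x => x.coeff g) h1
  simp only [single_mul_single, coeff_smul, Finsupp.smul_apply, coeff_setSum] at h2
  have h3 : (∑ a ∈ A.toFinite.toFinset, ∑ b ∈ B.toFinite.toFinset,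
      single (a + q ^ e • b) ((1 : ZMod q) * 1)).coeff g = 0 := by
    simp only [coeff_sum, Finsupp.finsetSum_apply, coeff_single]
    refine Finset.sum_eq_zero fun a ha => Finset.sum_eq_zero fun b hb => ?_
    rw [Finsupp.single_apply, if_neg]
    exact hne a (by simpa using ha) b (by simpa using hb)
  rw [h3] at h2
  have h4 : (Nat.card B : ZMod q) ≠ 0 := by
    rwa [Ne, ZMod.natCast_eq_zero_iff]
  rw [if_pos (Set.mem_univ g), smul_eq_mul, mul_one] at h2
  exact pow_ne_zero _ h4 h2.symm

open Polynomial in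
/-- If `G` is cyclic of order `N` with generator `g`, and `X ^ N - 1` divides `Φ_N * D`, then one of
the factors of a tiling of `G` is annihilated by `D(g)`. -/
theorem AddSubgroup.IsComplement.aeval_mul_setSum_eq_zero {N : ℕ} (hN : 1 < N) (e : ZMod N ≃+ G)
    {A B : Set G} (h : AddSubgroup.IsComplement A B) {D : ℚ[X]}
    (hD : (X ^ N - 1 : ℚ[X]) ∣ cyclotomic N ℚ * D) :
    aeval (single (e 1) (1 : ℚ)) D * setSum ℚ A = 0 ∨
      aeval (single (e 1) (1 : ℚ)) D * setSum ℚ B = 0 := by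
  classical
  have : NeZero N := ⟨by omega⟩
  have : Fact (1 < N) := ⟨hN⟩
  set ψ : AddChar (ZMod N) ℂ := ZMod.stdAddChar
  have hψ : Function.Injective ψ := ZMod.injective_stdAddChar
  set ζ : ℂ := ψ 1 with hζdef
  have hζpow : ∀ l : ℕ, ζ ^ l = ψ l := by
    intro l
    rw [hζdef, ← AddChar.map_nsmul_eq_pow]; simp
  have hζ : IsPrimitiveRoot ζ N := by
    refine IsPrimitiveRoot.mk_of_lt ζ (by omega) ?_ ?_
    · rw [hζpow]; simp
    · intro l hl hlN hl1
      rw [hζpow, ← AddChar.map_zero_eq_one ψ] at hl1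
      have := hψ hl1
      rw [ZMod.natCast_eq_zero_iff] at this
      exact absurd (Nat.le_of_dvd hl this) (by omega)
  set ev : AddMonoidAlgebra ℚ G →ₐ[ℚ] ℂ :=
    AddMonoidAlgebra.lift ℚ ℂ G (ψ.toMonoidHom.comp (AddMonoidHom.toMultiplicative
      (e.symm : G →+ ZMod N))) with hev
  have hevs : ∀ (g : G) (r : ℚ), ev (single g r) = r • ψ (e.symm g) := by
    intro g r
    rw [hev, lift_single]; rfl
  have hsurj : ∀ u : AddMonoidAlgebra ℚ G, ∃ U : ℚ[X], aeval (single (e 1) (1 : ℚ)) U = u := by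
    intro u
    induction u using AddMonoidAlgebra.induction_on with
    | of m =>
      refine ⟨X ^ (e.symm m).val, ?_⟩
      rw [map_pow, aeval_X, single_pow, one_pow, ← map_nsmul]
      simp [AddMonoidAlgebra.of]
    | add u v hu hv =>
      obtain ⟨U, rfl⟩ := hu
      obtain ⟨V, rfl⟩ := hv
      exact ⟨U + V, map_add _ _ _⟩
    | smul r u hu =>
      obtain ⟨U, rfl⟩ := hu
      exact ⟨r • U, map_smul _ _ _⟩
  -- If `u = U(g)` is killed by the character, then `Φ_N ∣ U`, so `X ^ N - 1` divides `U * D`; and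
  -- `g ^ N = 1` in the group ring.
  have key : ∀ u : AddMonoidAlgebra ℚ G, ev u = 0 →
      aeval (single (e 1) (1 : ℚ)) D * u = 0 := by
    intro u hu
    obtain ⟨U, rfl⟩ := hsurj u
    rw [← aeval_algHom_apply, hevs] at hu
    simp only [AddEquiv.symm_apply_apply, one_smul] at hu
    have hdvd : cyclotomic N ℚ ∣ U := by
      rw [cyclotomic_eq_minpoly_rat hζ (by omega)]
      exact minpoly.dvd ℚ ζ hu
    obtain ⟨W, hW⟩ := (hD.trans (mul_dvd_mul_right hdvd D))
    rw [← map_mul, mul_comm, hW, map_mul, map_sub, map_pow, aeval_X, single_pow, ← map_nsmul]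
    simp [AddMonoidAlgebra.one_def]
  -- Translation by `e 1` fixes the sum of `G` but multiplies its character value by `ψ 1 ≠ 1`.
  have huniv : ev (setSum ℚ (Set.univ : Set G)) = 0 := by
    have h1 := congrArg ev (single_mul_setSum_univ ℚ (e 1))
    rw [map_mul, hevs] at h1
    simp only [AddEquiv.symm_apply_apply, one_smul] at h1
    have hne : ψ 1 ≠ 1 := by
      rw [← AddChar.map_zero_eq_one ψ]
      exact fun h => one_ne_zero (hψ h)
    by_contra h0
    exact hne (by simpa [h0] using h1)
  rw [← setSum_mul_setSum ℚ h, map_mul, mul_eq_zero] at huniv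
  exact huniv.imp (key _) (key _)

end GroupRing

/-! ### Quotients of tilings, and annihilating polynomials read as difference equations. -/

section Tilings

open AddMonoidAlgebra

namespace AddSubgroup.IsComplement

variable {G H : Type*} [AddCommGroup G] [AddCommGroup H]

theorem symm {A B : Set G} (h : IsComplement A B) : IsComplement B A := by
  rw [isComplement_iff_existsUnique] at h ⊢
  intro g
  obtain ⟨⟨a, b⟩, hab, hu⟩ := h g
  refine ⟨⟨b, a⟩, (add_comm _ _).trans hab, ?_⟩
  rintro ⟨b', a'⟩ hab'
  have := hu (a', b') ((add_comm _ _).trans hab')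
  simp only [Prod.mk.injEq] at this
  simp [this.1, this.2]

theorem exists_add {A B : Set G} (h : IsComplement A B) (g : G) :
    ∃ a ∈ A, ∃ b ∈ B, a + b = g := by
  obtain ⟨⟨a, b⟩, hab⟩ := h.2 g
  exact ⟨a, a.2, b, b.2, hab⟩

theorem add_inj {A B : Set G} (h : IsComplement A B) {a a' b b' : G} (ha : a ∈ A) (ha' : a' ∈ A)
    (hb : b ∈ B) (hb' : b' ∈ B) (hab : a + b = a' + b') : a = a' ∧ b = b' := by
  have := @h.1 (⟨a, ha⟩, ⟨b, hb⟩) (⟨a', ha'⟩, ⟨b', hb'⟩) hab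
  simpa using this

theorem of_exists_of_inj {A B : Set G} (h₁ : ∀ g, ∃ a ∈ A, ∃ b ∈ B, a + b = g)
    (h₂ : ∀ a ∈ A, ∀ a' ∈ A, ∀ b ∈ B, ∀ b' ∈ B, a + b = a' + b' → a = a' ∧ b = b') :
    IsComplement A B := by
  refine ⟨?_, fun g => ?_⟩
  · rintro ⟨⟨a, ha⟩, ⟨b, hb⟩⟩ ⟨⟨a', ha'⟩, ⟨b', hb'⟩⟩ heq
    have := h₂ a ha a' ha' b hb b' hb' heq
    simp [this.1, this.2]
  · obtain ⟨a, ha, b, hb, hab⟩ := h₁ g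
    exact ⟨(⟨a, ha⟩, ⟨b, hb⟩), hab⟩

/-- A tiling one of whose factors is periodic modulo a subgroup descends to the quotient. -/
theorem image_of_ker_add_mem {A B : Set G} (h : IsComplement A B) {φ : G →+ H}
    (hφ : Function.Surjective φ) (hA : ∀ a ∈ A, ∀ x, φ x = 0 → a + x ∈ A) :
    IsComplement (φ '' A) (φ '' B) := by
  have key : ∀ a ∈ A, ∀ a' ∈ A, ∀ b ∈ B, ∀ b' ∈ B, φ a + φ b = φ a' + φ b' → b = b' := by
    intro a ha a' ha' b hb b' hb' heq
    have hx : φ (a + b - (a' + b')) = 0 := by simp [heq]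
    have := h.add_inj ha (hA a' ha' _ hx) hb hb' (by abel)
    exact this.2
  refine of_exists_of_inj (fun g => ?_) ?_
  · obtain ⟨x, rfl⟩ := hφ g
    obtain ⟨a, ha, b, hb, rfl⟩ := h.exists_add x
    exact ⟨φ a, ⟨a, ha, rfl⟩, φ b, ⟨b, hb, rfl⟩, (map_add _ _ _).symm⟩
  · rintro _ ⟨a, ha, rfl⟩ _ ⟨a', ha', rfl⟩ _ ⟨b, hb, rfl⟩ _ ⟨b', hb', rfl⟩ heq
    have := key a ha a' ha' b hb b' hb' heq
    subst this
    exact ⟨add_right_cancel heq, rfl⟩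

/-- The kernel element `b - b'` can be absorbed into `A`: compare `a + b` with `(a + (b - b')) +
b'`. -/
theorem eq_of_map_eq {A B : Set G} (h : IsComplement A B) {φ : G →+ H}
    (hA : ∀ a ∈ A, ∀ x, φ x = 0 → a + x ∈ A) {b b' : G} (hb : b ∈ B) (hb' : b' ∈ B)
    (hbb : φ b = φ b') : b = b' := by
  obtain ⟨a, ha⟩ := h.nonempty_left
  exact (h.add_inj ha (hA _ ha (b - b') (by simp [hbb])) hb hb' (by abel)).2

end AddSubgroup.IsComplement

variable {G : Type*} [AddCommGroup G] [Finite G]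

theorem add_nsmul_mem_iff_of_aeval_mul_eq_zero {A : Set G} {g : G} {m : ℕ}
    (h : Polynomial.aeval (single g (1 : ℚ)) (Polynomial.X ^ m - 1 : Polynomial ℚ) *
      setSum ℚ A = 0) (x : G) : x + m • g ∈ A ↔ x ∈ A := by
  classical
  have h1 := congrArg (fun u => u.coeff (x + m • g)) h
  simp only [map_sub, map_pow, Polynomial.aeval_X, map_one, single_pow, one_pow, sub_mul, one_mul,
    coeff_sub, Finsupp.sub_apply, coeff_single_mul_apply, coeff_setSum] at h1
  have h2 : -(m • g) + (x + m • g) = x := by abel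
  rw [h2] at h1
  by_cases hx : x ∈ A <;> by_cases hy : x + m • g ∈ A <;> simp_all

/-- Each factor `X ^ m - 1` acts on the indicator of `A` as a difference in direction `m • g`, so
the hypothesis is the vanishing of a mixed second difference. -/
theorem indicator_sub_eq_of_aeval_mul_eq_zero {A : Set G} [DecidablePred (· ∈ A)] {g : G} {m m' : ℕ}
    (h : Polynomial.aeval (single g (1 : ℚ))
      ((Polynomial.X ^ m - 1) * (Polynomial.X ^ m' - 1) : Polynomial ℚ) * setSum ℚ A = 0) (x : G) :
    (if x + m • g + m' • g ∈ A then 1 else 0 : ℚ) - (if x + m' • g ∈ A then 1 else 0) =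
      (if x + m • g ∈ A then 1 else 0) - (if x ∈ A then 1 else 0) := by
  have h1 := congrArg (fun u => u.coeff (x + m • g + m' • g)) h
  simp only [map_mul, mul_assoc, map_sub, map_pow, Polynomial.aeval_X, map_one, single_pow, one_pow,
    sub_mul, mul_sub, one_mul, coeff_sub, Finsupp.sub_apply, coeff_single_mul_apply,
    coeff_setSum, coeff_zero, Finsupp.zero_apply] at h1
  have h2 : -(m' • g) + (x + m' • g) = x := by abel
  have h3 : -(m • g) + (x + m • g + m' • g) = x + m' • g := by abel
  have h4 : -(m' • g) + (x + m • g + m' • g) = x + m • g := by abel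
  simp only [h2, h3, h4] at h1
  linarith

theorem add_nsmul_eq_of_add_eq {G M : Type*} [AddCommGroup G] {F : G → M} {h : G}
    (hF : ∀ x, F (x + h) = F x) (n : ℕ) (x : G) : F (x + n • h) = F x := by
  induction n with
  | zero => simp
  | succ n ih => rw [succ_nsmul, ← add_assoc, hF, ih]

-- Substituting `X ^ q` in `Φ_{p^(k+1)} * (X ^ p^k - 1) = X ^ p^(k+1) - 1` and using `Φ_{p^(k+1)}(X
-- ^ q) = Φ_{p^(k+1) q} * Φ_{p^(k+1)}` gives the claim with quotient `X ^ p^k - 1`.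
open Polynomial in
theorem X_pow_sub_one_dvd_cyclotomic_mul {p q : ℕ} (hp : p.Prime) (hq : q.Prime) (hpq : p ≠ q)
    (k : ℕ) : (X ^ (p ^ (k + 1) * q) - 1 : ℚ[X]) ∣
      cyclotomic (p ^ (k + 1) * q) ℚ * ((X ^ (p ^ k * q) - 1) * (X ^ (p ^ (k + 1)) - 1)) := by
  have : Fact p.Prime := ⟨hp⟩
  have hnd : ¬ q ∣ p ^ (k + 1) := fun h =>
    hpq ((Nat.prime_dvd_prime_iff_eq hq hp).1 (hq.dvd_of_dvd_pow h)).symm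
  have h1 := cyclotomic_expand_eq_cyclotomic_mul hq hnd ℚ
  have h2 := cyclotomic_prime_pow_mul_X_pow_sub_one ℚ p k
  have h3 := congrArg (expand ℚ q) h2
  simp only [map_mul, map_sub, map_pow, expand_X, map_one, h1, ← pow_mul] at h3
  rw [mul_comm q, mul_comm q] at h3
  rw [← h3, ← h2]
  exact ⟨X ^ p ^ k - 1, by ring⟩

end Tilings

/-! ### Tilings of `ℤ/p^k`. -/

section PrimePower

open AddSubgroup

theorem ZMod.pow_dvd_intCast_iff {p k s : ℕ} (hs : s ≤ k) (z : ℤ) :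
    ((p : ZMod (p ^ k)) ^ s ∣ (z : ZMod (p ^ k))) ↔ (p : ℤ) ^ s ∣ z := by
  constructor
  · rintro ⟨c, hc⟩
    obtain ⟨c, rfl⟩ := ZMod.intCast_surjective c
    have h1 : ((z - (p : ℤ) ^ s * c : ℤ) : ZMod (p ^ k)) = 0 := by
      push_cast
      rw [hc, sub_self]
    rw [ZMod.intCast_zmod_eq_zero_iff_dvd] at h1
    have h2 : (p : ℤ) ^ s ∣ z - (p : ℤ) ^ s * c :=
      (pow_dvd_pow _ hs).trans (by exact_mod_cast h1)
    exact (dvd_sub_left (Dvd.intro c rfl)).1 h2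
  · rintro ⟨c, rfl⟩
    exact ⟨c, by push_cast; rfl⟩

/-- Reduction `ℤ/p^(k+1) → ℤ/p^k`. -/
def zmodReduce (p k : ℕ) : ZMod (p ^ (k + 1)) →+* ZMod (p ^ k) :=
  ZMod.castHom (pow_dvd_pow p k.le_succ) _

theorem zmodReduce_surjective (p k : ℕ) : Function.Surjective (zmodReduce p k) :=
  ZMod.castHom_surjective _

theorem pow_dvd_zmodReduce_iff {p k s : ℕ} (hs : s ≤ k) (x : ZMod (p ^ (k + 1))) :
    ((p : ZMod (p ^ k)) ^ s ∣ zmodReduce p k x) ↔ (p : ZMod (p ^ (k + 1))) ^ s ∣ x := by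
  obtain ⟨z, rfl⟩ := ZMod.intCast_surjective x
  rw [map_intCast, ZMod.pow_dvd_intCast_iff hs, ZMod.pow_dvd_intCast_iff (by omega)]

theorem exists_eq_nsmul_of_zmodReduce_eq_zero {p k : ℕ} (hp : p ≠ 0) {x : ZMod (p ^ (k + 1))}
    (hx : zmodReduce p k x = 0) : ∃ n : ℕ, x = n • (p : ZMod (p ^ (k + 1))) ^ k := by
  have : (p : ZMod (p ^ k)) ^ k ∣ zmodReduce p k x := by rw [hx]; exact dvd_zero _
  rw [pow_dvd_zmodReduce_iff le_rfl] at this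
  obtain ⟨c, hc⟩ := this
  have : NeZero (p ^ (k + 1)) := ⟨pow_ne_zero _ hp⟩
  exact ⟨c.val, by rw [hc, nsmul_eq_mul, ZMod.natCast_zmod_val, mul_comm]⟩

theorem add_nsmul_mem_of_add_mem {G : Type*} [AddCommGroup G] {A : Set G} {g : G}
    (h : ∀ a ∈ A, a + g ∈ A) (n : ℕ) : ∀ a ∈ A, a + n • g ∈ A := by
  induction n with
  | zero => simp
  | succ n ih => intro a ha; rw [succ_nsmul, ← add_assoc]; exact h _ (ih a ha)

variable {p : ℕ}

/-- Here `Φ_N * (X ^ p^k - 1)` is exactly `X ^ N - 1`, so the factor killed by the character is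
annihilated by `X ^ p^k - 1`. -/
theorem AddSubgroup.IsComplement.periodic_or_periodic (hp : p.Prime) {k : ℕ}
    {A B : Set (ZMod (p ^ (k + 1)))} (h : IsComplement A B) :
    (∀ a ∈ A, a + (p : ZMod (p ^ (k + 1))) ^ k ∈ A) ∨
      (∀ b ∈ B, b + (p : ZMod (p ^ (k + 1))) ^ k ∈ B) := by
  have : Fact p.Prime := ⟨hp⟩
  have hN : 1 < p ^ (k + 1) := Nat.one_lt_pow (by omega) hp.one_lt
  have : NeZero (p ^ (k + 1)) := ⟨by omega⟩
  have hD : (Polynomial.X ^ (p ^ (k + 1)) - 1 : Polynomial ℚ) ∣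
      Polynomial.cyclotomic (p ^ (k + 1)) ℚ * (Polynomial.X ^ (p ^ k) - 1) := by
    rw [Polynomial.cyclotomic_prime_pow_mul_X_pow_sub_one]
  have hper : ∀ A : Set (ZMod (p ^ (k + 1))), Polynomial.aeval (AddMonoidAlgebra.single
      ((AddEquiv.refl (ZMod (p ^ (k + 1)))) 1) (1 : ℚ)) (Polynomial.X ^ (p ^ k) - 1 : Polynomial ℚ) *
      setSum ℚ A = 0 → ∀ a ∈ A, a + (p : ZMod (p ^ (k + 1))) ^ k ∈ A := by
    intro A h a ha
    have := (add_nsmul_mem_iff_of_aeval_mul_eq_zero h a).2 ha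
    simpa using this
  exact (h.aeval_mul_setSum_eq_zero hN (AddEquiv.refl _) hD).imp (hper A) (hper B)

/-- Every digit position of a tiling of `ℤ/p^k` is determined by the lower ones in one of the two
factors. -/
theorem AddSubgroup.IsComplement.exists_digits (hp : p.Prime) {k : ℕ} {A B : Set (ZMod (p ^ k))}
    (h : IsComplement A B) : ∃ σ : ℕ → Prop, ∀ s < k,
      (¬ σ s → ∀ a ∈ A, ∀ a' ∈ A, (p : ZMod (p ^ k)) ^ s ∣ a - a' →
        (p : ZMod (p ^ k)) ^ (s + 1) ∣ a - a') ∧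
      (σ s → ∀ b ∈ B, ∀ b' ∈ B, (p : ZMod (p ^ k)) ^ s ∣ b - b' →
        (p : ZMod (p ^ k)) ^ (s + 1) ∣ b - b') := by
  induction k with
  | zero => exact ⟨fun _ => True, by simp⟩
  | succ k ih =>
    have step : ∀ A B : Set (ZMod (p ^ (k + 1))), IsComplement A B →
        (∀ a ∈ A, a + (p : ZMod (p ^ (k + 1))) ^ k ∈ A) →
        ∃ σ : ℕ → Prop, ∀ s < k + 1,
          (¬ σ s → ∀ a ∈ A, ∀ a' ∈ A, (p : ZMod (p ^ (k + 1))) ^ s ∣ a - a' →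
            (p : ZMod (p ^ (k + 1))) ^ (s + 1) ∣ a - a') ∧
          (σ s → ∀ b ∈ B, ∀ b' ∈ B, (p : ZMod (p ^ (k + 1))) ^ s ∣ b - b' →
            (p : ZMod (p ^ (k + 1))) ^ (s + 1) ∣ b - b') := by
      intro A B h hA
      have hA' : ∀ a ∈ A, ∀ x, (zmodReduce p k).toAddMonoidHom x = 0 → a + x ∈ A := by
        intro a ha x hx
        obtain ⟨n, rfl⟩ := exists_eq_nsmul_of_zmodReduce_eq_zero hp.ne_zero hx
        exact add_nsmul_mem_of_add_mem hA n a ha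
      obtain ⟨σ, hσ⟩ := ih (h.image_of_ker_add_mem (zmodReduce_surjective p k) hA')
      refine ⟨fun s => s = k ∨ σ s, fun s hs => ⟨fun hsσ a ha a' ha' hd => ?_,
        fun hsσ b hb b' hb' hd => ?_⟩⟩
      · have hsk : s < k := by
          have : s ≠ k := fun h => hsσ (Or.inl h)
          omega
        have := (hσ s hsk).1 (fun h => hsσ (Or.inr h)) _ ⟨a, ha, rfl⟩ _ ⟨a', ha', rfl⟩
        rw [← map_sub] at this
        exact (pow_dvd_zmodReduce_iff (by omega) _).1 (this ((pow_dvd_zmodReduce_iff hsk.le _).2 hd))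
      -- The top digit is free in the periodic factor `A`; in `B`, elements congruent modulo `p^k`
      -- differ by a period of `A` and so coincide.
      · rcases eq_or_ne s k with rfl | hsk
        · rw [← pow_dvd_zmodReduce_iff le_rfl, ← Nat.cast_pow, ZMod.natCast_self, zero_dvd_iff,
            map_sub, sub_eq_zero] at hd
          rw [h.eq_of_map_eq hA' hb hb' hd, sub_self]
          exact dvd_zero _
        · have hsk' : s < k := by omega
          have := (hσ s hsk').2 (hsσ.resolve_left hsk) _ ⟨b, hb, rfl⟩ _ ⟨b', hb', rfl⟩
          rw [← map_sub] at this
          exact (pow_dvd_zmodReduce_iff (by omega) _).1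
            (this ((pow_dvd_zmodReduce_iff hsk'.le _).2 hd))
    rcases h.periodic_or_periodic hp with hA | hB
    · exact step A B h hA
    · obtain ⟨σ, hσ⟩ := step B A h.symm hB
      refine ⟨fun s => ¬ σ s, fun s hs => ⟨fun h => (hσ s hs).2 (not_not.1 h), (hσ s hs).1⟩⟩

end PrimePower

/-! ### Periodicity in `ℤ/p^(k+1) × ℤ/q`. -/

section PrimePowerTimesPrime

open AddSubgroup

/-- The projection of a subset of `G × H` to `G × {0}`. -/
def flatten {G H : Type*} [Zero H] (B : Set (G × H)) : Set (G × H) :=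
  (fun b => (b.1, 0)) '' B

theorem natCast_pow_ne_zero {p : ℕ} (hp : p.Prime) (k : ℕ) : (p : ZMod (p ^ (k + 1))) ^ k ≠ 0 := by
  rw [← Nat.cast_pow, Ne, ZMod.natCast_eq_zero_iff]
  exact fun h => absurd (Nat.le_of_dvd (pow_pos hp.pos k) h)
    (not_le.2 (Nat.pow_lt_pow_right hp.one_lt k.lt_succ_self))

variable {p q : ℕ}

/-- The two shifts are `(q * p^k, 0)` and `(0, p^(k+1))`. By coprimality their multiples include
`(p^k, 0)` and every `(0, y)`, so the mixed difference vanishes for these as well. -/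
theorem indicator_sub_eq (hp : p.Prime) (hq : q.Prime) (hpq : p ≠ q) {k : ℕ}
    [NeZero (p ^ (k + 1))] [NeZero q] {A : Set (ZMod (p ^ (k + 1)) × ZMod q)} [DecidablePred (· ∈ A)]
    (h : Polynomial.aeval (AddMonoidAlgebra.single
      ((1, 1) : ZMod (p ^ (k + 1)) × ZMod q) (1 : ℚ))
      ((Polynomial.X ^ (p ^ k * q) - 1) * (Polynomial.X ^ (p ^ (k + 1)) - 1) : Polynomial ℚ) *
      setSum ℚ A = 0)
    (x : ZMod (p ^ (k + 1))) (y y' : ZMod q) :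
    ((if (x + (p : ZMod (p ^ (k + 1))) ^ k, y) ∈ A then 1 else 0 : ℚ) -
        if (x, y) ∈ A then 1 else 0) =
      (if (x + (p : ZMod (p ^ (k + 1))) ^ k, y') ∈ A then 1 else 0) -
        if (x, y') ∈ A then 1 else 0 := by
  have hcop : (p ^ (k + 1)).Coprime q := Nat.Coprime.pow_left _ ((Nat.coprime_primes hp hq).2 hpq)
  set c : ZMod (p ^ (k + 1)) := (p : ZMod (p ^ (k + 1))) ^ k with hc
  have h0 := indicator_sub_eq_of_aeval_mul_eq_zero h
  have e1 : (p ^ k * q) • ((1, 1) : ZMod (p ^ (k + 1)) × ZMod q) =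
      ((q : ZMod (p ^ (k + 1))) * c, 0) := by
    ext <;> simp [hc, mul_comm]
  have e2 : (p ^ (k + 1)) • ((1, 1) : ZMod (p ^ (k + 1)) × ZMod q) =
      (0, ((p ^ (k + 1) : ℕ) : ZMod q)) := by
    ext
    · change p ^ (k + 1) • (1 : ZMod (p ^ (k + 1))) = 0
      rw [nsmul_eq_mul, mul_one, ZMod.natCast_self]
    · simp
  rw [e1, e2] at h0
  set d : ZMod q := ((p ^ (k + 1) : ℕ) : ZMod q) with hd
  set f : ZMod (p ^ (k + 1)) × ZMod q → ℚ := fun x => if x ∈ A then 1 else 0 with hf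
  have hn : ((q : ZMod (p ^ (k + 1)))⁻¹).val • ((q : ZMod (p ^ (k + 1))) * c, (0 : ZMod q)) =
      (c, 0) := by
    ext
    · change ((q : ZMod (p ^ (k + 1)))⁻¹).val • ((q : ZMod (p ^ (k + 1))) * c) = c
      rw [nsmul_eq_mul, ZMod.natCast_zmod_val, ← mul_assoc,
        mul_comm _ (q : ZMod (p ^ (k + 1))), ZMod.coe_mul_inv_eq_one q hcop.symm, one_mul]
    · simp
  have hm : ∀ y : ZMod q, (y * d⁻¹).val • ((0 : ZMod (p ^ (k + 1))), d) = (0, y) := by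
    intro y
    ext
    · simp
    · change (y * d⁻¹).val • d = y
      rw [nsmul_eq_mul, ZMod.natCast_zmod_val, mul_assoc, mul_comm _ d,
        ZMod.coe_mul_inv_eq_one _ hcop, mul_one]
  have h1 : ∀ x, f (x + (c, 0) + (0, d)) - f (x + (c, 0)) = f (x + (0, d)) - f x := by
    intro x
    have := add_nsmul_eq_of_add_eq (F := fun x => f (x + (0, d)) - f x)
      (h := ((q : ZMod (p ^ (k + 1))) * c, 0))
      (fun x => by have := h0 x; simp only [hf]; linarith)
      ((q : ZMod (p ^ (k + 1)))⁻¹).val x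
    rw [hn] at this
    exact this
  have h2 : ∀ x y, f (x + (0, y) + (c, 0)) - f (x + (0, y)) = f (x + (c, 0)) - f x := by
    intro x y
    have := add_nsmul_eq_of_add_eq (F := fun x => f (x + (c, 0)) - f x) (h := (0, d))
      (fun x => by have := h1 x; rw [add_right_comm]; linarith) (y * d⁻¹).val x
    rw [hm] at this
    exact this
  have h3 := h2 (x, y') (y - y')
  simpa [hf] using h3

/-- In a tiling of `ℤ/p^(k+1) × ℤ/q` in which the second factor may be flattened, the first factor
is `p`-periodic or `q`-periodic, or the second one is `p`-periodic. -/
theorem AddSubgroup.IsComplement.periodic_trichotomy (hp : p.Prime) (hq : q.Prime) (hpq : p ≠ q)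
    {k : ℕ} {A B : Set (ZMod (p ^ (k + 1)) × ZMod q)} (h : IsComplement A B)
    (h' : IsComplement A (flatten B)) :
    (∀ a ∈ A, a + ((p : ZMod (p ^ (k + 1))) ^ k, 0) ∈ A) ∨
    (∀ b ∈ B, b + ((p : ZMod (p ^ (k + 1))) ^ k, 0) ∈ B) ∨
    (∀ a ∈ A, ∀ y, (a.1, y) ∈ A) := by
  classical
  have : NeZero (p ^ (k + 1)) := ⟨pow_ne_zero _ hp.ne_zero⟩
  have : NeZero q := ⟨hq.ne_zero⟩
  have hcop : (p ^ (k + 1)).Coprime q := Nat.Coprime.pow_left _ ((Nat.coprime_primes hp hq).2 hpq)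
  -- Adding an element of `flatten B` does not change the `ℤ/q`-coordinate, so the flattened tiling
  -- splits into one tiling for each `y`.
  have hlayer : ∀ y : ZMod q, IsComplement {x | (x, y) ∈ A} (Prod.fst '' B) := by
    intro y
    refine IsComplement.of_exists_of_inj (fun x => ?_) ?_
    · obtain ⟨a, ha, _, ⟨b, hb, rfl⟩, hab⟩ := h'.exists_add (x, y)
      obtain ⟨h1, h2⟩ := Prod.ext_iff.1 hab
      simp only [Prod.snd_add, add_zero, Prod.fst_add] at h1 h2
      exact ⟨a.1, by rw [← h2]; exact ha, b.1, ⟨b, hb, rfl⟩, h1⟩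
    · rintro a ha a' ha' _ ⟨b, hb, rfl⟩ _ ⟨b', hb', rfl⟩ heq
      have := h'.add_inj ha ha' ⟨b, hb, rfl⟩ ⟨b', hb', rfl⟩ (by ext <;> simp [heq])
      simpa using this
  by_cases hB : ∀ x ∈ Prod.fst '' B, x + (p : ZMod (p ^ (k + 1))) ^ k ∈ Prod.fst '' B
  swap
  · left
    rintro ⟨x, y⟩ ha
    have := ((hlayer y).periodic_or_periodic hp).resolve_right hB x ha
    simpa using this
  right
  have hdisj : ∀ x y, (x, y) ∈ A → (x + (p : ZMod (p ^ (k + 1))) ^ k, y) ∉ A := by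
    intro x y hx hx'
    obtain ⟨z, hz⟩ := (hlayer y).nonempty_right
    have := ((hlayer y).add_inj hx' hx hz (hB z hz) (by abel)).1
    exact natCast_pow_ne_zero hp k (by simpa using this)
  have hN : 1 < p ^ (k + 1) * q :=
    lt_of_lt_of_le (Nat.one_lt_pow (by omega) hp.one_lt) (Nat.le_mul_of_pos_right _ hq.pos)
  have hone : (ZMod.chineseRemainder hcop).toAddEquiv 1 = (1, 1) :=
    map_one (ZMod.chineseRemainder hcop)
  have key := h.aeval_mul_setSum_eq_zero hN (ZMod.chineseRemainder hcop).toAddEquiv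
    (X_pow_sub_one_dvd_cyclotomic_mul hp hq hpq k)
  rw [hone] at key
  rcases key with key | key
  -- For a point of `A` the difference in direction `p^k` is `-1`, hence it is `-1` at every `y'`,
  -- which forces `(x, y') ∈ A`.
  · right
    rintro ⟨x, y⟩ ha y'
    have h1 := indicator_sub_eq hp hq hpq key x y y'
    rw [if_neg (hdisj x y ha), if_pos ha] at h1
    by_contra hy'
    simp only at hy'
    rw [if_neg hy'] at h1
    split_ifs at h1 <;> norm_num at h1
  -- Some `(x + p^k, y')` lies in `B`, so the difference at `y'` is nonnegative; hence it is
  -- nonnegative at `y`, where it would be `-1` if `(x + p^k, y)` were missing.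
  · left
    rintro ⟨x, y⟩ hb
    obtain ⟨⟨x', y'⟩, hb', hx'⟩ := hB x ⟨_, hb, rfl⟩
    simp only at hx'
    subst hx'
    have h1 := indicator_sub_eq hp hq hpq key x y y'
    rw [if_pos hb, if_pos hb'] at h1
    by_contra hy
    have hy : (x + (p : ZMod (p ^ (k + 1))) ^ k, y) ∉ B := by simpa using hy
    rw [if_neg hy] at h1
    split_ifs at h1 <;> norm_num at h1

end PrimePowerTimesPrime

/-! ### The digit structure of tilings of `ℤ/p^k × ℤ/q`. -/

section DigitTilings

open AddSubgroup

variable {p q : ℕ}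

/-- The digit structure of a tiling of `ℤ/p^k × ℤ/q`: the digit at position `s` is determined by the
preceding coordinates in `A` (if `¬ σ s`) or in `B` (if `σ s`), and the `ℤ/q`-coordinate comes
before the digit at position `j` and is determined by the preceding digits in `B`. -/
structure IsDigitTiling (p k q : ℕ) (σ : ℕ → Prop) (j : ℕ)
    (A B : Set (ZMod (p ^ k) × ZMod q)) : Prop where
  le : j ≤ k
  left : ∀ s < k, ¬ σ s → ∀ a ∈ A, ∀ a' ∈ A, (p : ZMod (p ^ k)) ^ s ∣ a.1 - a'.1 →
    (j ≤ s → a.2 = a'.2) → (p : ZMod (p ^ k)) ^ (s + 1) ∣ a.1 - a'.1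
  right : ∀ s < k, σ s → ∀ b ∈ B, ∀ b' ∈ B, (p : ZMod (p ^ k)) ^ s ∣ b.1 - b'.1 →
    (p : ZMod (p ^ k)) ^ (s + 1) ∣ b.1 - b'.1
  snd_eq : ∀ b ∈ B, ∀ b' ∈ B, (p : ZMod (p ^ k)) ^ j ∣ b.1 - b'.1 → b.2 = b'.2

theorem natCast_pow_dvd_self_iff {p k : ℕ} (x : ZMod (p ^ k)) :
    (p : ZMod (p ^ k)) ^ k ∣ x ↔ x = 0 := by
  rw [← Nat.cast_pow, ZMod.natCast_self, zero_dvd_iff]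

/-- Modulo `ℤ/q` the tiling becomes one of `ℤ/p^k`, and `B` injects into the quotient. The
`ℤ/q`-coordinate can therefore be put last. -/
theorem IsDigitTiling.of_snd_periodic (hp : p.Prime) {k : ℕ}
    {A B : Set (ZMod (p ^ k) × ZMod q)} (h : IsComplement A B)
    (hA : ∀ a ∈ A, ∀ y, (a.1, y) ∈ A) : ∃ σ, IsDigitTiling p k q σ k A B := by
  have hA' : ∀ a ∈ A, ∀ x, AddMonoidHom.fst (ZMod (p ^ k)) (ZMod q) x = 0 → a + x ∈ A := by
    rintro ⟨a, b⟩ ha ⟨x, y⟩ hx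
    simp only [AddMonoidHom.coe_fst] at hx
    subst hx
    simpa using hA _ ha (b + y)
  obtain ⟨σ, hσ⟩ := (h.image_of_ker_add_mem Prod.fst_surjective hA').exists_digits hp
  refine ⟨σ, le_rfl, fun s hs hsσ a ha a' ha' hd _ => ?_, fun s hs hsσ b hb b' hb' hd => ?_,
    fun b hb b' hb' hd => ?_⟩
  · exact (hσ s hs).1 hsσ _ ⟨a, ha, rfl⟩ _ ⟨a', ha', rfl⟩ hd
  · exact (hσ s hs).2 hsσ _ ⟨b, hb, rfl⟩ _ ⟨b', hb', rfl⟩ hd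
  · rw [natCast_pow_dvd_self_iff, sub_eq_zero] at hd
    rw [h.eq_of_map_eq hA' hb hb' hd]

/-- Reduction `ℤ/p^(k+1) × ℤ/q → ℤ/p^k × ℤ/q`. -/
def prodReduce (p k q : ℕ) : ZMod (p ^ (k + 1)) × ZMod q →+ ZMod (p ^ k) × ZMod q :=
  (zmodReduce p k).toAddMonoidHom.prodMap (AddMonoidHom.id (ZMod q))

theorem prodReduce_surjective (p k q : ℕ) : Function.Surjective (prodReduce p k q) :=
  (zmodReduce_surjective p k).prodMap Function.surjective_id

theorem pow_dvd_prodReduce_iff {k s : ℕ} (hs : s ≤ k) (x y : ZMod (p ^ (k + 1)) × ZMod q) :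
    ((p : ZMod (p ^ k)) ^ s ∣ (prodReduce p k q x).1 - (prodReduce p k q y).1) ↔
      (p : ZMod (p ^ (k + 1))) ^ s ∣ x.1 - y.1 := by
  rw [← pow_dvd_zmodReduce_iff hs, map_sub]
  rfl

theorem prodReduce_eq_iff {k : ℕ} (x y : ZMod (p ^ (k + 1)) × ZMod q) :
    prodReduce p k q x = prodReduce p k q y ↔
      (p : ZMod (p ^ (k + 1))) ^ k ∣ x.1 - y.1 ∧ x.2 = y.2 := by
  rw [← pow_dvd_prodReduce_iff le_rfl, natCast_pow_dvd_self_iff, sub_eq_zero, Prod.ext_iff]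
  rfl

theorem image_prodReduce_flatten (k : ℕ) (B : Set (ZMod (p ^ (k + 1)) × ZMod q)) :
    prodReduce p k q '' flatten B = flatten (prodReduce p k q '' B) := by
  rw [flatten, flatten, Set.image_image, Set.image_image]
  simp [prodReduce]

theorem add_mem_of_prodReduce_eq_zero (hp : p.Prime) {k : ℕ}
    {A : Set (ZMod (p ^ (k + 1)) × ZMod q)}
    (hA : ∀ a ∈ A, a + ((p : ZMod (p ^ (k + 1))) ^ k, 0) ∈ A) :
    ∀ a ∈ A, ∀ x, prodReduce p k q x = 0 → a + x ∈ A := by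
  rintro a ha ⟨x, y⟩ hx
  obtain ⟨hx, rfl⟩ := Prod.ext_iff.1 hx
  obtain ⟨n, rfl⟩ := exists_eq_nsmul_of_zmodReduce_eq_zero hp.ne_zero hx
  have := add_nsmul_mem_of_add_mem hA n a ha
  convert this using 2
  ext
  · rfl
  · exact (smul_zero n).symm

/-- Induction through the quotient by the period `p^k`. The flattened tiling descends along with the
original one, because the trichotomy needs it again at each level. -/
theorem AddSubgroup.IsComplement.exists_isDigitTiling_of_flatten (hp : p.Prime) (hq : q.Prime)
    (hpq : p ≠ q) {k : ℕ} {A B : Set (ZMod (p ^ k) × ZMod q)} (h : IsComplement A B)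
    (h' : IsComplement A (flatten B)) : ∃ σ j, IsDigitTiling p k q σ j A B := by
  induction k with
  | zero =>
    -- For `k = 0` the flattened `B` is `{0}`, so `A` is the whole group.
    obtain ⟨σ, hσ⟩ := IsDigitTiling.of_snd_periodic hp h (by
      rintro a ha y
      obtain ⟨a', ha', _, ⟨b, hb, rfl⟩, hab⟩ := h'.exists_add (a.1, y)
      obtain ⟨-, h2⟩ := Prod.ext_iff.1 hab
      have : Subsingleton (ZMod (p ^ 0)) := by rw [pow_zero]; infer_instance
      have h3 : a' = (a.1, y) := by
        ext1
        · exact Subsingleton.elim _ _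
        · exact (add_zero a'.2).symm.trans h2
      exact h3 ▸ ha')
    exact ⟨σ, 0, hσ⟩
  | succ k ih =>
    rcases h.periodic_trichotomy hp hq hpq h' with hA | hB | hA
    · have hA' := add_mem_of_prodReduce_eq_zero hp hA
      obtain ⟨σ, j, hσ⟩ := ih (h.image_of_ker_add_mem (prodReduce_surjective p k q) hA')
        (image_prodReduce_flatten k B ▸
          h'.image_of_ker_add_mem (prodReduce_surjective p k q) hA')
      have hsnd : ∀ b ∈ B, ∀ b' ∈ B, (p : ZMod (p ^ (k + 1))) ^ j ∣ b.1 - b'.1 → b.2 = b'.2 :=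
        fun b hb b' hb' hd => hσ.snd_eq _ ⟨b, hb, rfl⟩ _ ⟨b', hb', rfl⟩
          ((pow_dvd_prodReduce_iff hσ.le b b').2 hd)
      refine ⟨fun s => s = k ∨ σ s, j, hσ.le.trans k.le_succ, fun s hs hsσ a ha a' ha' hd hj => ?_,
        fun s hs hsσ b hb b' hb' hd => ?_, hsnd⟩
      · rw [not_or] at hsσ
        have hsk : s < k := by omega
        exact (pow_dvd_prodReduce_iff (by omega) _ _).1 (hσ.left s hsk hsσ.2 _ ⟨a, ha, rfl⟩ _
          ⟨a', ha', rfl⟩ ((pow_dvd_prodReduce_iff hsk.le _ _).2 hd) hj)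
      · rcases eq_or_ne s k with rfl | hsk
        · rw [h.eq_of_map_eq hA' hb hb' ((prodReduce_eq_iff b b').2
            ⟨hd, hsnd b hb b' hb' ((pow_dvd_pow _ hσ.le).trans hd)⟩), sub_self]
          exact dvd_zero _
        · have hsk' : s < k := by omega
          exact (pow_dvd_prodReduce_iff (by omega) _ _).1 (hσ.right s hsk'
            (hsσ.resolve_left hsk) _ ⟨b, hb, rfl⟩ _ ⟨b', hb', rfl⟩
            ((pow_dvd_prodReduce_iff hsk'.le _ _).2 hd))
    · have hB' := add_mem_of_prodReduce_eq_zero hp hB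
      have hBf : ∀ b ∈ flatten B, b + ((p : ZMod (p ^ (k + 1))) ^ k, 0) ∈ flatten B := by
        rintro _ ⟨b, hb, rfl⟩
        exact ⟨_, hB b hb, by simp⟩
      obtain ⟨σ, j, hσ⟩ := ih
        (h.symm.image_of_ker_add_mem (prodReduce_surjective p k q) hB').symm
        (image_prodReduce_flatten k B ▸ (h'.symm.image_of_ker_add_mem
          (prodReduce_surjective p k q) (add_mem_of_prodReduce_eq_zero hp hBf)).symm)
      refine ⟨fun s => s ≠ k ∧ σ s, j, hσ.le.trans k.le_succ, fun s hs hsσ a ha a' ha' hd hj => ?_,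
        fun s hs hsσ b hb b' hb' hd => ?_, fun b hb b' hb' hd => hσ.snd_eq _ ⟨b, hb, rfl⟩ _
          ⟨b', hb', rfl⟩ ((pow_dvd_prodReduce_iff hσ.le b b').2 hd)⟩
      · rcases eq_or_ne s k with rfl | hsk
        · rw [h.symm.eq_of_map_eq hB' ha ha' ((prodReduce_eq_iff a a').2 ⟨hd, hj hσ.le⟩),
            sub_self]
          exact dvd_zero _
        · have hsk' : s < k := by omega
          exact (pow_dvd_prodReduce_iff (by omega) _ _).1 (hσ.left s hsk'
            (fun h => hsσ ⟨hsk, h⟩) _ ⟨a, ha, rfl⟩ _ ⟨a', ha', rfl⟩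
            ((pow_dvd_prodReduce_iff hsk'.le _ _).2 hd) hj)
      · have hsk : s < k := by
          have := hsσ.1
          omega
        exact (pow_dvd_prodReduce_iff (by omega) _ _).1 (hσ.right s hsk hsσ.2 _ ⟨b, hb, rfl⟩ _
          ⟨b', hb', rfl⟩ ((pow_dvd_prodReduce_iff hsk.le _ _).2 hd))
    · obtain ⟨σ, hσ⟩ := IsDigitTiling.of_snd_periodic hp h hA
      exact ⟨σ, k + 1, hσ⟩

/-- By Euler, multiplication by `q ^ φ(p^k)` is the identity on `ℤ/p^k` and zero on `ℤ/q`, so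
flattening is an instance of `exists_add_pow_nsmul`. Covering becomes tiling by counting pairs. -/
theorem AddSubgroup.IsComplement.flatten_right (hp : p.Prime) (hq : q.Prime) (hpq : p ≠ q) {k : ℕ}
    {A B : Set (ZMod (p ^ k) × ZMod q)} (h : IsComplement A B) (hB : ¬ q ∣ Nat.card B) :
    IsComplement A (flatten B) := by
  have : NeZero (p ^ k) := ⟨pow_ne_zero _ hp.ne_zero⟩
  have : NeZero q := ⟨hq.ne_zero⟩
  have hcop : q.Coprime (p ^ k) := Nat.Coprime.pow_right _ ((Nat.coprime_primes hq hp).2 hpq.symm)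
  have hmul : ∀ b : ZMod (p ^ k) × ZMod q, q ^ (p ^ k).totient • b = (b.1, 0) := by
    intro b
    ext
    · change q ^ (p ^ k).totient • b.1 = b.1
      have := (ZMod.natCast_eq_natCast_iff _ _ _).2 (Nat.ModEq.pow_totient hcop)
      rw [nsmul_eq_mul, this, Nat.cast_one, one_mul]
    · change q ^ (p ^ k).totient • b.2 = 0
      rw [nsmul_eq_mul, Nat.cast_pow, ZMod.natCast_self, zero_pow, zero_mul]
      exact (Nat.totient_pos.2 (pow_pos hp.pos _)).ne'
  have hsurj : Function.Surjective
      (fun x : A × B => (x.1 : ZMod (p ^ k) × ZMod q) + ((x.2 : ZMod (p ^ k) × ZMod q).1, 0)) := by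
    intro g
    obtain ⟨a, ha, b, hb, hab⟩ := h.exists_add_pow_nsmul hq hB (p ^ k).totient g
    rw [hmul] at hab
    exact ⟨(⟨a, ha⟩, ⟨b, hb⟩), hab⟩
  have hinj := (Nat.bijective_iff_surjective_and_card _).2
    ⟨hsurj, by rw [Nat.card_prod, h.card_mul_card]⟩ |>.1
  refine IsComplement.of_exists_of_inj (fun g => ?_) ?_
  · obtain ⟨⟨a, b⟩, hab⟩ := hsurj g
    exact ⟨a, a.2, _, ⟨b, b.2, rfl⟩, hab⟩
  · rintro a ha a' ha' _ ⟨b, hb, rfl⟩ _ ⟨b', hb', rfl⟩ heq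
    have := @hinj (⟨a, ha⟩, ⟨b, hb⟩) (⟨a', ha'⟩, ⟨b', hb'⟩) heq
    simp only [Prod.mk.injEq, Subtype.mk.injEq] at this
    simp [this.1, this.2]

/-- Every tiling of `ℤ/p^k × ℤ/q` has a digit structure, up to exchanging the factors. -/
theorem AddSubgroup.IsComplement.exists_isDigitTiling (hp : p.Prime) (hq : q.Prime)
    (hpq : p ≠ q) {k : ℕ} {A B : Set (ZMod (p ^ k) × ZMod q)} (h : IsComplement A B) :
    (∃ σ j, IsDigitTiling p k q σ j A B) ∨ ∃ σ j, IsDigitTiling p k q σ j B A := by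
  -- Since `|A| * |B| = p^k * q`, the prime `q` divides only one of the cardinalities; the other
  -- factor is the one to flatten.
  by_cases hB : q ∣ Nat.card B
  · refine Or.inr (h.symm.exists_isDigitTiling_of_flatten hp hq hpq
      (h.symm.flatten_right hp hq hpq fun hA => ?_))
    have h1 := mul_dvd_mul hA hB
    rw [h.card_mul_card, Nat.card_prod, Nat.card_zmod, Nat.card_zmod,
      Nat.mul_dvd_mul_iff_right hq.pos] at h1
    exact hpq ((Nat.prime_dvd_prime_iff_eq hq hp).1 (hq.dvd_of_dvd_pow h1)).symm
  · exact Or.inl (h.exists_isDigitTiling_of_flatten hp hq hpq (h.flatten_right hp hq hpq hB))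

end DigitTilings

/-! ### Tilings from injective parametrizations of the right size. -/

section Counting

open AddSubgroup Finset

theorem AddSubgroup.IsComplement.of_injective_of_card {G X Y : Type*} [AddCommGroup G] [Finite G]
    {f : X → G} {g : Y → G} (hinj : ∀ x x' y y', f x + g y = f x' + g y' → x = x' ∧ y = y')
    (hcard : Nat.card X * Nat.card Y = Nat.card G) : IsComplement (Set.range f) (Set.range g) := by
  have hb : Function.Bijective (fun z : X × Y => f z.1 + g z.2) := by
    rw [Nat.bijective_iff_injective_and_card]
    refine ⟨fun z z' h => ?_, by rw [Nat.card_prod, hcard]⟩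
    obtain ⟨h1, h2⟩ := hinj _ _ _ _ h
    exact Prod.ext h1 h2
  refine IsComplement.of_exists_of_inj (fun z => ?_) ?_
  · obtain ⟨⟨x, y⟩, h⟩ := hb.2 z
    exact ⟨_, ⟨x, rfl⟩, _, ⟨y, rfl⟩, h⟩
  · rintro _ ⟨x, rfl⟩ _ ⟨x', rfl⟩ _ ⟨y, rfl⟩ _ ⟨y', rfl⟩ h
    obtain ⟨rfl, rfl⟩ := hinj _ _ _ _ h
    exact ⟨rfl, rfl⟩

/-- The set of values of `F` on the tuples `(i_0, …, i_{n-1}, j)` with `i_t < a t` and `j < c`. -/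
def boxImage {G : Type*} (n : ℕ) (a : ℕ → ℕ) (c : ℕ) (F : (ℕ → ℕ) → ℕ → G) : Set G :=
  {g | ∃ (i : ℕ → ℕ) (j : ℕ), (∀ t < n, i t < a t) ∧ j < c ∧ g = F i j}

/-- Extension of a tuple by zero. -/
def extendTuple {n : ℕ} {a : ℕ → ℕ} (x : (t : Fin n) → Fin (a t)) (t : ℕ) : ℕ :=
  if h : t < n then (x ⟨t, h⟩ : ℕ) else 0

theorem boxImage_eq_range {G : Type*} {n : ℕ} {a : ℕ → ℕ} {c : ℕ} {F : (ℕ → ℕ) → ℕ → G}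
    (hF : ∀ i i' j, (∀ t < n, i t = i' t) → F i j = F i' j) :
    boxImage n a c F =
      Set.range fun x : ((t : Fin n) → Fin (a t)) × Fin c => F (extendTuple x.1) x.2 := by
  ext g
  constructor
  · rintro ⟨i, j, hi, hj, rfl⟩
    refine ⟨(fun t => ⟨i t, hi t t.2⟩, ⟨j, hj⟩), hF _ _ _ fun t ht => ?_⟩
    simp [extendTuple, ht]
  · rintro ⟨⟨x, j⟩, rfl⟩
    refine ⟨extendTuple x, j, fun t ht => ?_, j.2, rfl⟩
    simp [extendTuple, ht]

theorem AddSubgroup.IsComplement.boxImage {G : Type*} [AddCommGroup G] [Finite G] {n : ℕ}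
    {a b : ℕ → ℕ} {c d : ℕ} {F F' : (ℕ → ℕ) → ℕ → G}
    (hF : ∀ i i' j, (∀ t < n, i t = i' t) → F i j = F i' j)
    (hF' : ∀ i i' j, (∀ t < n, i t = i' t) → F' i j = F' i' j)
    (hcard : (∏ t ∈ range n, a t * b t) * (c * d) = Nat.card G)
    (hinj : ∀ x x' y y' : ℕ → ℕ, ∀ i i' j j' : ℕ, (∀ t < n, x t < a t) → (∀ t < n, x' t < a t) →
      (∀ t < n, y t < b t) → (∀ t < n, y' t < b t) → i < c → i' < c → j < d → j' < d →
      F x i + F' y j = F x' i' + F' y' j' →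
      (∀ t < n, x t = x' t ∧ y t = y' t) ∧ i = i' ∧ j = j') :
    IsComplement (boxImage n a c F) (_root_.boxImage n b d F') := by
  rw [boxImage_eq_range hF, boxImage_eq_range hF']
  have hlt : ∀ {a : ℕ → ℕ} (x : (t : Fin n) → Fin (a t)), ∀ t < n, extendTuple x t < a t := by
    intro a x t ht
    simp [extendTuple, ht]
  have hext : ∀ {a : ℕ → ℕ} (x x' : (t : Fin n) → Fin (a t)),
      (∀ t < n, extendTuple x t = extendTuple x' t) → x = x' := by
    intro a x x' h
    funext t
    have := h t t.2
    simpa [extendTuple, Fin.ext_iff] using this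
  refine IsComplement.of_injective_of_card ?_ ?_
  · rintro ⟨x, i⟩ ⟨x', i'⟩ ⟨y, j⟩ ⟨y', j'⟩ h
    obtain ⟨h1, h2, h3⟩ := hinj _ _ _ _ _ _ _ _ (hlt x) (hlt x') (hlt y) (hlt y') i.2 i'.2 j.2
      j'.2 h
    exact ⟨Prod.ext (hext _ _ fun t ht => (h1 t ht).1) (Fin.ext h2),
      Prod.ext (hext _ _ fun t ht => (h1 t ht).2) (Fin.ext h3)⟩
  · rw [← hcard, prod_mul_distrib]
    simp only [Nat.card_eq_fintype_card, Fintype.card_prod, Fintype.card_pi, Fintype.card_fin,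
      prod_range]
    ring

theorem eq_of_dvd_natCast_sub {N x y : ℕ} (hx : x < N) (hy : y < N)
    (h : (N : ℤ) ∣ (x : ℤ) - y) : x = y :=
  (Nat.ModEq.eq_of_lt_of_lt (Nat.modEq_iff_dvd.2 h) hy hx).symm

end Counting

/-! ### Successive elimination of digits. -/

section Triangular

open Finset

/-- The triangular elimination: if a combination of digits and correction terms vanishes modulo
`p^k`, then the digits vanish successively. -/
theorem triangular_elimination {p : ℕ} (hp : p ≠ 0) {n : ℕ} {m l : ℕ → ℕ}
    (hm : ∀ t < n, m t + l t ≤ m (t + 1)) {u a v b : ℕ → ℤ} {E : ℕ → Prop} (h0 : E 0)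
    (step : ∀ s < n, E s → (p : ℤ) ^ l s ∣ u s → u s = 0 ∧ a s = 0 ∧
      ((p : ℤ) ^ (m (s + 1) - m s - l s) ∣ v s → v s = 0 ∧ b s = 0 ∧ E (s + 1)))
    (h : (p : ℤ) ^ m n ∣ ∑ t ∈ range n,
      (u t * (p : ℤ) ^ m t + (a t + v t) * (p : ℤ) ^ (m t + l t) + b t * (p : ℤ) ^ m (t + 1))) :
    E n := by
  have hp' : (p : ℤ) ≠ 0 := by exact_mod_cast hp
  have hmono : ∀ s t, s ≤ t → t ≤ n → m s ≤ m t := by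
    intro s t hst
    induction t, hst using Nat.le_induction with
    | base => intro _; rfl
    | succ t hst ih => intro ht; have := ih (by omega); have := hm t (by omega); omega
  suffices H : ∀ s ≤ n, E s ∧ ∀ t < s, u t = 0 ∧ a t = 0 ∧ v t = 0 ∧ b t = 0 from (H n le_rfl).1
  intro s
  induction s with
  | zero => exact fun _ => ⟨h0, by simp⟩
  | succ s ih =>
    intro hs
    obtain ⟨hE, hz⟩ := ih (by omega)
    have hsplit : ∑ t ∈ range n, (u t * (p : ℤ) ^ m t + (a t + v t) * (p : ℤ) ^ (m t + l t) +
        b t * (p : ℤ) ^ m (t + 1)) =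
        (u s * (p : ℤ) ^ m s + (a s + v s) * (p : ℤ) ^ (m s + l s)) + (b s * (p : ℤ) ^ m (s + 1) +
        ∑ t ∈ Ico (s + 1) n, (u t * (p : ℤ) ^ m t + (a t + v t) * (p : ℤ) ^ (m t + l t) +
          b t * (p : ℤ) ^ m (t + 1))) := by
      rw [range_eq_Ico, ← sum_Ico_consecutive _ (Nat.zero_le s) (by omega : s ≤ n),
        sum_eq_sum_Ico_succ_bot (by omega : s < n), sum_eq_zero]
      · ring
      · intro t ht
        obtain ⟨h1, h2, h3, h4⟩ := hz t (mem_Ico.1 ht).2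
        simp [h1, h2, h3, h4]
    rw [hsplit] at h
    -- Earlier terms vanish and the tail is divisible by `p ^ m (s + 1)`. Reading the remainder
    -- modulo `p ^ (m s + l s)` isolates `u s`, and then modulo `p ^ m (s + 1)` it isolates `v s`.
    have htail : (p : ℤ) ^ m (s + 1) ∣ b s * (p : ℤ) ^ m (s + 1) +
        ∑ t ∈ Ico (s + 1) n, (u t * (p : ℤ) ^ m t + (a t + v t) * (p : ℤ) ^ (m t + l t) +
          b t * (p : ℤ) ^ m (t + 1)) := by
      refine dvd_add (dvd_mul_left _ _) (dvd_sum fun t ht => ?_)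
      rw [mem_Ico] at ht
      have h1 := hmono _ _ ht.1 (by omega : t ≤ n)
      have h2 := hm t ht.2
      exact dvd_add (dvd_add (dvd_mul_of_dvd_right (pow_dvd_pow _ h1) _)
        (dvd_mul_of_dvd_right (pow_dvd_pow _ (by omega)) _))
        (dvd_mul_of_dvd_right (pow_dvd_pow _ (by omega)) _)
    have hhead := (dvd_add_left htail).1 ((pow_dvd_pow _ (hmono _ _ hs le_rfl)).trans h)
    have hms := hm s (by omega)
    have hu : (p : ℤ) ^ l s ∣ u s := by
      have h1 : (p : ℤ) ^ (m s + l s) ∣ u s * (p : ℤ) ^ m s :=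
        (dvd_add_left (dvd_mul_left _ _)).1 ((pow_dvd_pow _ hms).trans hhead)
      rw [pow_add, mul_comm (u s)] at h1
      exact (mul_dvd_mul_iff_left (pow_ne_zero _ hp')).1 h1
    obtain ⟨hu0, ha0, hstep⟩ := step s (by omega) hE hu
    have hv : (p : ℤ) ^ (m (s + 1) - m s - l s) ∣ v s := by
      rw [hu0, ha0, zero_mul, zero_add, zero_add,
        show m (s + 1) = (m s + l s) + (m (s + 1) - m s - l s) by omega, pow_add, mul_comm (v s)]
        at hhead
      exact (mul_dvd_mul_iff_left (pow_ne_zero _ hp')).1 hhead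
    obtain ⟨hv0, hb0, hE'⟩ := hstep hv
    refine ⟨hE', fun t ht => ?_⟩
    rcases Nat.lt_succ_iff_lt_or_eq.1 ht with ht | rfl
    · exact hz t ht
    · exact ⟨hu0, ha0, hv0, hb0⟩

end Triangular

/-! ### The four families are tilings. -/

namespace PerfectCode

open AddSubgroup Finset

variable {p q k n r : ℕ} {m l : ℕ → ℕ}

theorem elt_add (x y x' y' : ℤ) :
    elt p k q x y + elt p k q x' y' = elt p k q (x + x') (y + y') := by
  simp [elt]

theorem elt_eq_iff {x y x' y' : ℤ} :
    elt p k q x y = elt p k q x' y' ↔ (p : ℤ) ^ k ∣ x - x' ∧ (q : ℤ) ∣ y - y' := by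
  rw [elt, elt, Prod.mk.injEq, eq_comm, ZMod.intCast_eq_intCast_iff_dvd_sub, Nat.cast_pow,
    eq_comm (a := ((y : ℤ) : ZMod q)), ZMod.intCast_eq_intCast_iff_dvd_sub]

theorem pre_congr {i i' : ℕ → ℕ} {t : ℕ} (h : ∀ u < t, i u = i' u) : pre i t = pre i' t :=
  List.map_congr_left fun u hu => h u (List.mem_range.1 hu)

theorem Admissible.add_le (h : Admissible k n r m l) {t : ℕ} (ht : t < n) :
    m t + l t ≤ m (t + 1) := by
  have h1 := h.l_le t ht
  rcases eq_or_ne t r with rfl | htr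
  · have := h.m_r_le
    omega
  · have := h.m_lt t ht htr
    omega

theorem sum_range_erase (f : ℕ → ℤ) (n r : ℕ) :
    ∑ t ∈ (range n).erase r, f t = ∑ t ∈ range n, if t = r then 0 else f t := by
  rw [← filter_ne', sum_filter]
  exact sum_congr rfl fun t _ => by split_ifs <;> simp_all

theorem sum_range_add_sum_Ico (f g : ℕ → ℤ) (h : r ≤ n) :
    ∑ t ∈ range r, f t + ∑ t ∈ Ico r n, g t = ∑ t ∈ range n, if t < r then f t else g t := by
  rw [range_eq_Ico, range_eq_Ico, ← sum_Ico_consecutive _ (Nat.zero_le r) h]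
  congr 1
  · exact sum_congr rfl fun t ht => by rw [if_pos (mem_Ico.1 ht).2]
  · exact sum_congr rfl fun t ht => by rw [if_neg (not_lt.2 (mem_Ico.1 ht).1)]

theorem prod_pow_mul_pow (hm : ∀ t < n, m t + l t ≤ m (t + 1)) (h0 : m 0 = 0) :
    ∏ t ∈ range n, p ^ l t * p ^ (m (t + 1) - m t - l t) = p ^ m n := by
  induction n with
  | zero => simp [h0]
  | succ n ih =>
    rw [prod_range_succ, ih fun t ht => hm t (by omega), ← pow_add, ← pow_add]
    have := hm n (by omega)
    congr 1
    omega

/-- A pair of families of elements whose parameters can be eliminated successively is a tiling. -/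
theorem isComplement_of_elimination (hp : p.Prime) (hq : q.Prime) (h : Admissible k n r m l)
    {a b : ℕ → ℕ} {c d : ℕ} {ξ A η B : (ℕ → ℕ) → ℕ → ℕ → ℤ} {w z : (ℕ → ℕ) → ℕ → ℤ}
    {F F' : (ℕ → ℕ) → ℕ → ZMod (p ^ k) × ZMod q}
    (hFdef : ∀ i j, F i j = elt p k q
      (∑ t ∈ range n, (ξ i j t * (p : ℤ) ^ m t + A i j t * (p : ℤ) ^ (m t + l t))) (w i j))
    (hFdef' : ∀ i j, F' i j = elt p k q
      (∑ t ∈ range n, (η i j t * (p : ℤ) ^ (m t + l t) + B i j t * (p : ℤ) ^ m (t + 1))) (z i j))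
    (hF : ∀ i i' j, (∀ t < n, i t = i' t) → w i j = w i' j ∧
      ∀ t < n, ξ i j t = ξ i' j t ∧ A i j t = A i' j t)
    (hF' : ∀ i i' j, (∀ t < n, i t = i' t) → z i j = z i' j ∧
      ∀ t < n, η i j t = η i' j t ∧ B i j t = B i' j t)
    (hcard : (∏ t ∈ range n, a t * b t) * (c * d) = p ^ k * q)
    (hE : ∀ x x' y y' : ℕ → ℕ, ∀ i i' j j' : ℕ, (∀ t < n, x t < a t) → (∀ t < n, x' t < a t) →
      (∀ t < n, y t < b t) → (∀ t < n, y' t < b t) → i < c → i' < c → j < d → j' < d →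
      (q : ℤ) ∣ w x i + z y j - (w x' i' + z y' j') →
      ∃ E : ℕ → Prop, E 0 ∧ (E n → (∀ t < n, x t = x' t ∧ y t = y' t) ∧ i = i' ∧ j = j') ∧
        ∀ s < n, E s → (p : ℤ) ^ l s ∣ ξ x i s - ξ x' i' s →
          ξ x i s - ξ x' i' s = 0 ∧ A x i s - A x' i' s = 0 ∧
          ((p : ℤ) ^ (m (s + 1) - m s - l s) ∣ η y j s - η y' j' s →
            η y j s - η y' j' s = 0 ∧ B y j s - B y' j' s = 0 ∧ E (s + 1))) :
    IsComplement (boxImage n a c F) (boxImage n b d F') := by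
  have : NeZero (p ^ k) := ⟨pow_ne_zero _ hp.ne_zero⟩
  have : NeZero q := ⟨hq.ne_zero⟩
  refine IsComplement.boxImage ?_ ?_ ?_ ?_
  · intro i i' j hi
    obtain ⟨h1, h2⟩ := hF i i' j hi
    rw [hFdef, hFdef, h1]
    congr 1
    exact sum_congr rfl fun t ht => by
      rw [(h2 t (mem_range.1 ht)).1, (h2 t (mem_range.1 ht)).2]
  · intro i i' j hi
    obtain ⟨h1, h2⟩ := hF' i i' j hi
    rw [hFdef', hFdef', h1]
    congr 1
    exact sum_congr rfl fun t ht => by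
      rw [(h2 t (mem_range.1 ht)).1, (h2 t (mem_range.1 ht)).2]
  · rw [hcard, Nat.card_prod, Nat.card_zmod, Nat.card_zmod]
  · intro x x' y y' i i' j j' hx hx' hy hy' hi hi' hj hj' heq
    rw [hFdef, hFdef, hFdef', hFdef', elt_add, elt_add, elt_eq_iff] at heq
    obtain ⟨hpd, hqd⟩ := heq
    obtain ⟨E, hE0, hEn, hstep⟩ := hE x x' y y' i i' j j' hx hx' hy hy' hi hi' hj hj' hqd
    refine hEn (triangular_elimination (m := m) (l := l) hp.ne_zero (fun t ht => h.add_le ht) hE0 hstep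
      (b := fun s => B y j s - B y' j' s) ?_)
    rw [h.m_last]
    convert hpd using 1
    simp only [← sum_add_distrib, ← sum_sub_distrib]
    exact sum_congr rfl fun t _ => by ring

/-- As `m r + l r = m (r + 1)`, the code has no `p`-digits in block `r`; slot `r` carries the
`ℤ/q`-coordinate instead, recovered once `i_0, …, i_r` of the other factor are known. -/
theorem isComplement_setA_codeA (hp : p.Prime) (hq : q.Prime) (h : Admissible k n r m l)
    (hr : m r + l r = m (r + 1)) (α β : List ℕ → ℤ) :
    IsComplement (setA p k q n r m l α) (codeA p k q n r m l β) := by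
  have hset : setA p k q n r m l α = boxImage n (fun t => p ^ l t) 1 fun i _ => elt p k q
      ((∑ t ∈ Finset.range n, (i t : ℤ) * (p : ℤ) ^ m t)
        + ∑ t ∈ (Finset.range n).erase r, α (pre i (t + 1)) * (p : ℤ) ^ (m t + l t))
      (α (pre i (r + 1))) := by
    ext; simp [setA, boxImage]
  have hcode : codeA p k q n r m l β =
      boxImage n (fun t => if t = r then q else p ^ (m (t + 1) - m t - l t)) 1 fun i _ => elt p k q
      ((∑ t ∈ (Finset.range n).erase r, (i t : ℤ) * (p : ℤ) ^ (m t + l t))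
        + ∑ t ∈ Finset.range n, β (pre i (t + 1)) * (p : ℤ) ^ m (t + 1))
      (i r) := by
    ext x
    simp only [codeA, boxImage, Set.mem_ofPred_eq]
    refine exists_congr fun i => ⟨fun ⟨h1, h2, h3⟩ => ⟨0, fun t ht => ?_, one_pos, h3⟩,
      fun ⟨_, h1, _, h3⟩ => ⟨fun t ht htr => ?_, ?_, h3⟩⟩
    · split_ifs with htr
      · exact htr ▸ h2
      · exact h1 t ht htr
    · simpa [htr] using h1 t ht
    · simpa using h1 r h.r_lt
  rw [hset, hcode]
  have hrn := h.r_lt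
  refine isComplement_of_elimination hp hq h
    (ξ := fun i _ t => i t) (A := fun i _ t => if t = r then 0 else α (pre i (t + 1)))
    (η := fun i _ t => if t = r then 0 else (i t : ℤ)) (B := fun i _ t => β (pre i (t + 1)))
    (w := fun i _ => α (pre i (r + 1))) (z := fun i _ => i r) ?_ ?_ ?_ ?_ ?_ ?_
  · intro i j
    rw [sum_range_erase, ← sum_add_distrib]
    congr 1
    exact sum_congr rfl fun t _ => by split_ifs <;> simp
  · intro i j
    rw [sum_range_erase, ← sum_add_distrib]
    congr 1
    exact sum_congr rfl fun t _ => by split_ifs <;> simp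
  · intro i i' j hi
    refine ⟨by rw [pre_congr fun u hu => hi u (by omega)], fun t ht => ?_⟩
    rw [hi t ht, pre_congr fun u hu => hi u (by omega)]
    exact ⟨rfl, rfl⟩
  · intro i i' j hi
    refine ⟨by rw [hi r hrn], fun t ht => ?_⟩
    rw [hi t ht, pre_congr fun u hu => hi u (by omega)]
    exact ⟨rfl, rfl⟩
  · rw [← h.m_last, ← prod_pow_mul_pow (m := m) (l := l) (fun t ht => h.add_le ht) h.m_zero]
    have : ∀ t ∈ range n, p ^ l t * (if t = r then q else p ^ (m (t + 1) - m t - l t)) =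
        p ^ l t * p ^ (m (t + 1) - m t - l t) * (if t = r then q else 1) := by
      intro t ht
      split_ifs with htr
      · rw [htr, show m (r + 1) - m r - l r = 0 by omega, pow_zero, mul_one]
      · rw [mul_one]
    rw [prod_congr rfl this, prod_mul_distrib, prod_ite_eq', if_pos (mem_range.2 hrn)]
    simp
  · intro x x' y y' i i' j j' hx hx' hy hy' hi hi' hj hj' hqd
    refine ⟨fun s => ∀ t < s, x t = x' t ∧ y t = y' t, by simp,
      fun h => ⟨h, by omega, by omega⟩, fun s hs hEs hd => ?_⟩
    have hxs : x s = x' s :=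
      eq_of_dvd_natCast_sub (hx s hs) (hx' s hs) (by exact_mod_cast hd)
    have hpx : pre x (s + 1) = pre x' (s + 1) := pre_congr fun u hu => by
      rcases Nat.lt_succ_iff_lt_or_eq.1 hu with hu | rfl
      exacts [(hEs u hu).1, hxs]
    refine ⟨by simp [hxs], by simp [hpx], fun hd' => ?_⟩
    have hys : y s = y' s := by
      have h1 := hy s hs
      have h2 := hy' s hs
      by_cases hsr : s = r
      · subst hsr
        simp only [if_true, hpx, add_sub_add_left_eq_sub] at h1 h2 hqd
        exact eq_of_dvd_natCast_sub h1 h2 hqd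
      · simp only [hsr, if_false] at h1 h2 hd'
        exact eq_of_dvd_natCast_sub h1 h2 (by exact_mod_cast hd')
    have hpy : pre y (s + 1) = pre y' (s + 1) := pre_congr fun u hu => by
      rcases Nat.lt_succ_iff_lt_or_eq.1 hu with hu | rfl
      exacts [(hEs u hu).2, hys]
    refine ⟨by simp [hys], by simp [hpy], fun u hu => ?_⟩
    rcases Nat.lt_succ_iff_lt_or_eq.1 hu with hu | rfl
    exacts [hEs u hu, ⟨hxs, hys⟩]

end PerfectCode

namespace PerfectCode

open AddSubgroup Finset

variable {p q k n r : ℕ} {m l : ℕ → ℕ}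

/-- The index `j` is recovered at step `r`, when the second coordinate of the `S₀` part is known;
this is just in time for the corrections with `t ≥ r`, which depend on `j`. -/
theorem isComplement_setB_codeB (hp : p.Prime) (hq : q.Prime) (h : Admissible k n r m l)
    (α β : List ℕ → ℤ) :
    IsComplement (setB p k q n r m l α) (codeB p k q n r m l β) := by
  have hset : setB p k q n r m l α = boxImage n (fun t => p ^ l t) 1 fun i _ => elt p k q
      (∑ t ∈ Finset.range n,
        ((i t : ℤ) * (p : ℤ) ^ m t + α (pre i (t + 1)) * (p : ℤ) ^ (m t + l t)))
      (α (pre i (r + 1))) := by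
    ext; simp [setB, boxImage]
  rw [hset]
  have hrn := h.r_lt
  refine isComplement_of_elimination hp hq h (d := q) (b := fun t => p ^ (m (t + 1) - m t - l t))
    (ξ := fun i _ t => i t) (A := fun i _ t => α (pre i (t + 1)))
    (η := fun i _ t => i t)
    (B := fun i j t => if t < r then β (pre i (t + 1)) else β (pre i (t + 1) ++ [j]))
    (w := fun i _ => α (pre i (r + 1))) (z := fun _ j => j) (fun _ _ => rfl) ?_ ?_ ?_ ?_ ?_
  · intro i j
    rw [add_assoc, sum_range_add_sum_Ico _ _ hrn.le, ← sum_add_distrib]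
    congr 1
    exact sum_congr rfl fun t _ => by split_ifs <;> rfl
  · intro i i' j hi
    refine ⟨by rw [pre_congr fun u hu => hi u (by omega)], fun t ht => ?_⟩
    rw [hi t ht, pre_congr fun u hu => hi u (by omega)]
    exact ⟨rfl, rfl⟩
  · intro i i' j hi
    refine ⟨rfl, fun t ht => ?_⟩
    rw [hi t ht, pre_congr fun u hu => hi u (by omega)]
    exact ⟨rfl, rfl⟩
  · rw [← h.m_last, ← prod_pow_mul_pow (m := m) (l := l) (fun t ht => h.add_le ht) h.m_zero,
      one_mul]
  · intro x x' y y' i i' j j' hx hx' hy hy' hi hi' hj hj' hqd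
    refine ⟨fun s => (∀ t < s, x t = x' t ∧ y t = y' t) ∧ (r < s → j = j'), by simp,
      fun h => ⟨h.1, by omega, h.2 hrn⟩, fun s hs hEs hd => ?_⟩
    have hxs : x s = x' s :=
      eq_of_dvd_natCast_sub (hx s hs) (hx' s hs) (by exact_mod_cast hd)
    have hpx : pre x (s + 1) = pre x' (s + 1) := pre_congr fun u hu => by
      rcases Nat.lt_succ_iff_lt_or_eq.1 hu with hu | rfl
      exacts [(hEs.1 u hu).1, hxs]
    refine ⟨by simp [hxs], by simp [hpx], fun hd' => ?_⟩
    have hys : y s = y' s :=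
      eq_of_dvd_natCast_sub (hy s hs) (hy' s hs) (by exact_mod_cast hd')
    have hpy : pre y (s + 1) = pre y' (s + 1) := pre_congr fun u hu => by
      rcases Nat.lt_succ_iff_lt_or_eq.1 hu with hu | rfl
      exacts [(hEs.1 u hu).2, hys]
    have hjs : r < s + 1 → j = j' := by
      intro hrs
      rcases Nat.lt_succ_iff_lt_or_eq.1 hrs with hrs | rfl
      · exact hEs.2 hrs
      · simp only [hpx, add_sub_add_left_eq_sub] at hqd
        exact eq_of_dvd_natCast_sub hj hj' hqd
    refine ⟨by simp [hys], ?_, fun u hu => ?_, hjs⟩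
    · split_ifs with hsr
      · simp [hpy]
      · simp [hpy, hjs (by omega)]
    · rcases Nat.lt_succ_iff_lt_or_eq.1 hu with hu | rfl
      exacts [hEs.1 u hu, ⟨hxs, hys⟩]

/-- As `l r = 0`, slot `r` of `S₀` is free to carry the `ℤ/q`-coordinate. The second coordinate of
the code depends only on indices below `r`, so that slot is recovered at the start of step `r`. -/
theorem isComplement_setC_codeC (hp : p.Prime) (hq : q.Prime) (h : Admissible k n r m l)
    (hr : l r = 0) (α β : List ℕ → ℤ) :
    IsComplement (setC p k q n r m l α) (codeC p k q n r m l β) := by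
  have hset : setC p k q n r m l α =
      boxImage n (fun t => if t = r then q else p ^ l t) 1 fun i _ => elt p k q
      ((∑ t ∈ (Finset.range n).erase r, (i t : ℤ) * (p : ℤ) ^ m t)
        + ∑ t ∈ Finset.range n, α (pre i (t + 1)) * (p : ℤ) ^ (m t + l t))
      (i r) := by
    ext x
    simp only [setC, boxImage, Set.mem_ofPred_eq]
    refine exists_congr fun i => ⟨fun ⟨h1, h2, h3⟩ => ⟨0, fun t ht => ?_, one_pos, h3⟩,
      fun ⟨_, h1, _, h3⟩ => ⟨fun t ht htr => ?_, ?_, h3⟩⟩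
    · split_ifs with htr
      · exact htr ▸ h2
      · exact h1 t ht htr
    · simpa [htr] using h1 t ht
    · simpa using h1 r h.r_lt
  have hcode : codeC p k q n r m l β =
      boxImage n (fun t => p ^ (m (t + 1) - m t - l t)) 1 fun i _ => elt p k q
      ((∑ t ∈ Finset.range n, (i t : ℤ) * (p : ℤ) ^ (m t + l t))
        + ∑ t ∈ (Finset.range n).filter (fun t => t + 1 ≠ r),
            β (pre i (t + 1)) * (p : ℤ) ^ m (t + 1))
      (β (pre i r)) := by
    ext; simp [codeC, boxImage]
  rw [hset, hcode]
  have hrn := h.r_lt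
  refine isComplement_of_elimination hp hq h
    (ξ := fun i _ t => if t = r then 0 else (i t : ℤ)) (A := fun i _ t => α (pre i (t + 1)))
    (η := fun i _ t => i t) (B := fun i _ t => if t + 1 ≠ r then β (pre i (t + 1)) else 0)
    (w := fun i _ => i r) (z := fun i _ => β (pre i r)) ?_ ?_ ?_ ?_ ?_ ?_
  · intro i j
    rw [sum_range_erase, ← sum_add_distrib]
    congr 1
    exact sum_congr rfl fun t _ => by split_ifs <;> simp
  · intro i j
    rw [sum_filter, ← sum_add_distrib]
    congr 1
    exact sum_congr rfl fun t _ => by split_ifs <;> simp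
  · intro i i' j hi
    refine ⟨by rw [hi r hrn], fun t ht => ?_⟩
    rw [hi t ht, pre_congr fun u hu => hi u (by omega)]
    exact ⟨rfl, rfl⟩
  · intro i i' j hi
    refine ⟨by rw [pre_congr fun u hu => hi u (by omega)], fun t ht => ?_⟩
    rw [hi t ht, pre_congr fun u hu => hi u (by omega)]
    exact ⟨rfl, rfl⟩
  · rw [← h.m_last, ← prod_pow_mul_pow (m := m) (l := l) (fun t ht => h.add_le ht) h.m_zero]
    have : ∀ t ∈ range n, (if t = r then q else p ^ l t) * p ^ (m (t + 1) - m t - l t) =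
        p ^ l t * p ^ (m (t + 1) - m t - l t) * (if t = r then q else 1) := by
      intro t ht
      split_ifs with htr
      · rw [htr, hr, pow_zero, one_mul, mul_comm]
      · rw [mul_one]
    rw [prod_congr rfl this, prod_mul_distrib, prod_ite_eq', if_pos (mem_range.2 hrn)]
    simp
  · intro x x' y y' i i' j j' hx hx' hy hy' hi hi' hj hj' hqd
    refine ⟨fun s => ∀ t < s, x t = x' t ∧ y t = y' t, by simp,
      fun h => ⟨h, by omega, by omega⟩, fun s hs hEs hd => ?_⟩
    have hxs : x s = x' s := by
      have h1 := hx s hs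
      have h2 := hx' s hs
      by_cases hsr : s = r
      · subst hsr
        simp only [if_true, pre_congr fun u hu => (hEs u hu).2, add_sub_add_right_eq_sub]
          at h1 h2 hqd
        exact eq_of_dvd_natCast_sub h1 h2 hqd
      · simp only [hsr, if_false] at h1 h2 hd
        exact eq_of_dvd_natCast_sub h1 h2 (by exact_mod_cast hd)
    have hpx : pre x (s + 1) = pre x' (s + 1) := pre_congr fun u hu => by
      rcases Nat.lt_succ_iff_lt_or_eq.1 hu with hu | rfl
      exacts [(hEs u hu).1, hxs]
    refine ⟨by simp [hxs], by simp [hpx], fun hd' => ?_⟩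
    have hys : y s = y' s :=
      eq_of_dvd_natCast_sub (hy s hs) (hy' s hs) (by exact_mod_cast hd')
    have hpy : pre y (s + 1) = pre y' (s + 1) := pre_congr fun u hu => by
      rcases Nat.lt_succ_iff_lt_or_eq.1 hu with hu | rfl
      exacts [(hEs u hu).2, hys]
    refine ⟨by simp [hys], by simp [hpy], fun u hu => ?_⟩
    rcases Nat.lt_succ_iff_lt_or_eq.1 hu with hu | rfl
    exacts [hEs u hu, ⟨hxs, hys⟩]

theorem isComplement_setD_codeD (hp : p.Prime) (hq : q.Prime) (h : Admissible k n r m l)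
    (α β : List ℕ → ℤ) :
    IsComplement (setD p k q n r m l α) (codeD p k q n r m l β) := by
  have hcode : codeD p k q n r m l β =
      boxImage n (fun t => p ^ (m (t + 1) - m t - l t)) 1 fun i _ => elt p k q
      (∑ t ∈ Finset.range n,
        ((i t : ℤ) * (p : ℤ) ^ (m t + l t) + β (pre i (t + 1)) * (p : ℤ) ^ m (t + 1)))
      (β (pre i r)) := by
    ext; simp [codeD, boxImage]
  rw [hcode]
  have hrn := h.r_lt
  refine isComplement_of_elimination hp hq h (c := q) (a := fun t => p ^ l t)
    (ξ := fun i _ t => i t)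
    (A := fun i j t => if t < r then α (pre i (t + 1)) else α (pre i (t + 1) ++ [j]))
    (η := fun i _ t => i t) (B := fun i _ t => β (pre i (t + 1)))
    (w := fun _ j => j) (z := fun i _ => β (pre i r)) ?_ (fun _ _ => rfl) ?_ ?_ ?_ ?_
  · intro i j
    rw [add_assoc, sum_range_add_sum_Ico _ _ hrn.le, ← sum_add_distrib]
    congr 1
    exact sum_congr rfl fun t _ => by split_ifs <;> rfl
  · intro i i' j hi
    refine ⟨rfl, fun t ht => ?_⟩
    rw [hi t ht, pre_congr fun u hu => hi u (by omega)]
    exact ⟨rfl, rfl⟩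
  · intro i i' j hi
    refine ⟨by rw [pre_congr fun u hu => hi u (by omega)], fun t ht => ?_⟩
    rw [hi t ht, pre_congr fun u hu => hi u (by omega)]
    exact ⟨rfl, rfl⟩
  · rw [← h.m_last, ← prod_pow_mul_pow (m := m) (l := l) (fun t ht => h.add_le ht) h.m_zero,
      mul_one]
  · intro x x' y y' i i' j j' hx hx' hy hy' hi hi' hj hj' hqd
    refine ⟨fun s => (∀ t < s, x t = x' t ∧ y t = y' t) ∧ (r < s → i = i'), by simp,
      fun h => ⟨h.1, h.2 hrn, by omega⟩, fun s hs hEs hd => ?_⟩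
    have hxs : x s = x' s :=
      eq_of_dvd_natCast_sub (hx s hs) (hx' s hs) (by exact_mod_cast hd)
    have hpx : pre x (s + 1) = pre x' (s + 1) := pre_congr fun u hu => by
      rcases Nat.lt_succ_iff_lt_or_eq.1 hu with hu | rfl
      exacts [(hEs.1 u hu).1, hxs]
    have his : r < s + 1 → i = i' := by
      intro hrs
      rcases Nat.lt_succ_iff_lt_or_eq.1 hrs with hrs | rfl
      · exact hEs.2 hrs
      · simp only [pre_congr fun u hu => (hEs.1 u hu).2, add_sub_add_right_eq_sub] at hqd
        exact eq_of_dvd_natCast_sub hi hi' hqd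
    refine ⟨by simp [hxs], ?_, fun hd' => ?_⟩
    · split_ifs with hsr
      · simp [hpx]
      · simp [hpx, his (by omega)]
    have hys : y s = y' s :=
      eq_of_dvd_natCast_sub (hy s hs) (hy' s hs) (by exact_mod_cast hd')
    have hpy : pre y (s + 1) = pre y' (s + 1) := pre_congr fun u hu => by
      rcases Nat.lt_succ_iff_lt_or_eq.1 hu with hu | rfl
      exacts [(hEs.1 u hu).2, hys]
    refine ⟨by simp [hys], by simp [hpy], fun u hu => ?_, his⟩
    rcases Nat.lt_succ_iff_lt_or_eq.1 hu with hu | rfl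
    exacts [hEs.1 u hu, ⟨hxs, hys⟩]

end PerfectCode

/-! ### Blocks of base-`p` digits. -/

section Digits

variable {p q k : ℕ}

theorem pow_dvd_sub_iff_mod_eq [NeZero (p ^ k)] {u : ℕ} (hu : u ≤ k) (x y : ZMod (p ^ k)) :
    ((p : ZMod (p ^ k)) ^ u ∣ x - y) ↔ x.val % p ^ u = y.val % p ^ u := by
  have h : x - y = ((((x.val : ℤ) - (y.val : ℤ)) : ℤ) : ZMod (p ^ k)) := by simp
  rw [h, ZMod.pow_dvd_intCast_iff hu]
  change _ ↔ x.val ≡ y.val [MOD p ^ u]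
  rw [Nat.ModEq.comm, Nat.modEq_iff_dvd, Nat.cast_pow]

/-- The number formed by the `c` base-`p` digits of `x` from position `u` on. -/
def digitBlock (p : ℕ) {k : ℕ} (u c : ℕ) (x : ZMod (p ^ k)) : ℕ :=
  x.val / p ^ u % p ^ c

theorem pow_add_dvd_sub [NeZero (p ^ k)] {u c : ℕ} (hu : u + c ≤ k) {x y : ZMod (p ^ k)}
    (h : (p : ZMod (p ^ k)) ^ u ∣ x - y) (hd : digitBlock p u c x = digitBlock p u c y) :
    (p : ZMod (p ^ k)) ^ (u + c) ∣ x - y := by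
  rw [pow_dvd_sub_iff_mod_eq (by omega)] at h
  rw [pow_dvd_sub_iff_mod_eq hu, pow_add, Nat.mod_mul, Nat.mod_mul, h]
  exact congrArg _ (congrArg _ hd)

theorem digitBlock_eq_of_dvd [NeZero (p ^ k)] {u c v : ℕ} (huv : u + c = v) (hv : v ≤ k)
    {x y : ZMod (p ^ k)} (h : (p : ZMod (p ^ k)) ^ v ∣ x - y) :
    digitBlock p u c x = digitBlock p u c y := by
  subst huv
  rw [pow_dvd_sub_iff_mod_eq hv, pow_add] at h
  rw [digitBlock, digitBlock, ← Nat.mod_mul_right_div_self, h, Nat.mod_mul_right_div_self]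

theorem digitBlock_lt (hp : p.Prime) (u c : ℕ) (x : ZMod (p ^ k)) : digitBlock p u c x < p ^ c :=
  Nat.mod_lt _ (pow_pos hp.pos c)

@[simp]
theorem digitBlock_zero (u c : ℕ) : digitBlock p u c (0 : ZMod (p ^ k)) = 0 := by
  simp [digitBlock]

@[simp]
theorem digitBlock_zero_length (u : ℕ) (x : ZMod (p ^ k)) : digitBlock p u 0 x = 0 := by
  simp [digitBlock, Nat.mod_one]

theorem digitBlock_last [NeZero (p ^ k)] (c : ℕ) (x : ZMod (p ^ k)) : digitBlock p k c x = 0 := by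
  rw [digitBlock, Nat.div_eq_of_lt (ZMod.val_lt x), Nat.zero_mod]

theorem sum_digitBlock {n : ℕ} {m l : ℕ → ℕ} (h0 : m 0 = 0)
    (hm : ∀ t < n, m t + l t ≤ m (t + 1)) (x : ZMod (p ^ k)) :
    ∑ t ∈ Finset.range n, (digitBlock p (m t) (l t) x * p ^ m t +
      digitBlock p (m t + l t) (m (t + 1) - m t - l t) x * p ^ (m t + l t)) =
      x.val % p ^ m n := by
  induction n with
  | zero => simp [h0, Nat.mod_one]
  | succ n ih =>
    have h1 := hm n (by omega)
    rw [Finset.sum_range_succ, ih fun t ht => hm t (by omega)]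
    have h2 : x.val % p ^ m (n + 1) =
        x.val % (p ^ m n * p ^ l n * p ^ (m (n + 1) - m n - l n)) := by
      rw [← pow_add, ← pow_add]
      congr 2
      omega
    rw [h2, Nat.mod_mul, Nat.mod_mul]
    simp only [digitBlock, pow_add]
    ring

theorem IsDigitTiling.right_block {σ : ℕ → Prop} {j : ℕ} {A B : Set (ZMod (p ^ k) × ZMod q)}
    (h : IsDigitTiling p k q σ j A B) {u v : ℕ} (huv : u ≤ v) (hv : v ≤ k)
    (hσ : ∀ s, u ≤ s → s < v → σ s) {b b' : ZMod (p ^ k) × ZMod q} (hb : b ∈ B) (hb' : b' ∈ B)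
    (hd : (p : ZMod (p ^ k)) ^ u ∣ b.1 - b'.1) : (p : ZMod (p ^ k)) ^ v ∣ b.1 - b'.1 := by
  induction v, huv using Nat.le_induction with
  | base => exact hd
  | succ v huv ih =>
    exact h.right v hv (hσ v huv v.lt_succ_self) b hb b' hb'
      (ih (by omega) fun s hs hs' => hσ s hs (by omega))

theorem IsDigitTiling.left_block {σ : ℕ → Prop} {j : ℕ} {A B : Set (ZMod (p ^ k) × ZMod q)}
    (h : IsDigitTiling p k q σ j A B) {u v : ℕ} (huv : u ≤ v) (hv : v ≤ k)
    (hσ : ∀ s, u ≤ s → s < v → ¬ σ s) {a a' : ZMod (p ^ k) × ZMod q} (ha : a ∈ A) (ha' : a' ∈ A)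
    (hj : j < v → a.2 = a'.2)
    (hd : (p : ZMod (p ^ k)) ^ u ∣ a.1 - a'.1) : (p : ZMod (p ^ k)) ^ v ∣ a.1 - a'.1 := by
  induction v, huv using Nat.le_induction with
  | base => exact hd
  | succ v huv ih =>
    exact h.left v hv (hσ v huv v.lt_succ_self) a ha a' ha'
      (ih (by omega) (fun s hs hs' => hσ s hs (by omega)) fun h => hj (by omega))
      fun h => hj (by omega)

end Digits

/-! ### Digit expansions along the blocks, and coefficient families. -/

namespace PerfectCode

open Finset

variable {p q k n r : ℕ} {m l : ℕ → ℕ}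

theorem pre_eq_iff {i i' : ℕ → ℕ} {t : ℕ} : pre i t = pre i' t ↔ ∀ u < t, i u = i' u := by
  refine ⟨fun h u hu => ?_, pre_congr⟩
  have := congrArg (fun L => L[u]?) h
  simpa [pre, hu] using this

@[simp]
theorem length_pre (i : ℕ → ℕ) (t : ℕ) : (pre i t).length = t := by simp [pre]

/-- A function of a key extends to a normalized family of integers. -/
theorem exists_normalized {X : Type*} (key : X → List ℕ) (val : X → ℤ)
    (h : ∀ x x', key x = key x' → val x = val x')
    (h0 : ∀ x, (∀ i ∈ key x, i = 0) → val x = 0) :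
    ∃ α : List ℕ → ℤ, Normalized α ∧ ∀ x, α (key x) = val x := by
  classical
  refine ⟨fun L => if ∀ i ∈ L, i = 0 then 0 else
    if hL : ∃ x, key x = L then val hL.choose else 0, fun L hL => if_pos hL, fun x => ?_⟩
  simp only
  split_ifs with h1 h2
  · exact (h0 x h1).symm
  · exact h _ _ h2.choose_spec
  · exact absurd ⟨x, rfl⟩ h2

theorem eq_elt [NeZero (p ^ k)] [NeZero q] (x : ZMod (p ^ k) × ZMod q) :
    x = elt p k q (x.1.val : ℤ) (x.2.val : ℤ) := by
  ext <;> simp [elt]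

theorem Admissible.le_last (h : Admissible k n r m l) {s t : ℕ} (hst : s ≤ t) (ht : t ≤ n) :
    m s ≤ m t := by
  induction t, hst using Nat.le_induction with
  | base => rfl
  | succ t hst ih =>
    have h1 := ih (by omega)
    have h2 := h.add_le (t := t) (by omega)
    omega

theorem Admissible.le_k (h : Admissible k n r m l) {t : ℕ} (ht : t ≤ n) : m t ≤ k :=
  (h.le_last ht le_rfl).trans h.m_last.le

theorem Admissible.val_eq [NeZero (p ^ k)] (h : Admissible k n r m l) (x : ZMod (p ^ k)) :
    (x.val : ℤ) = ∑ t ∈ range n, ((digitBlock p (m t) (l t) x : ℤ) * (p : ℤ) ^ m t +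
      (digitBlock p (m t + l t) (m (t + 1) - m t - l t) x : ℤ) * (p : ℤ) ^ (m t + l t)) := by
  have h1 := sum_digitBlock (p := p) h.m_zero (fun t ht => h.add_le ht) x
  rw [h.m_last, Nat.mod_eq_of_lt (ZMod.val_lt x)] at h1
  rw [← h1]
  push_cast
  rfl

/-- Expansion of a member of the code: the digits of the blocks of `S` are shifted by one block. -/
theorem Admissible.val_eq' [NeZero (p ^ k)] (h : Admissible k n r m l) (x : ZMod (p ^ k))
    (hx : digitBlock p (m 0) (l 0) x = 0) :
    (x.val : ℤ) = ∑ t ∈ range n,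
      ((digitBlock p (m t + l t) (m (t + 1) - m t - l t) x : ℤ) * (p : ℤ) ^ (m t + l t) +
        (digitBlock p (m (t + 1)) (l (t + 1)) x : ℤ) * (p : ℤ) ^ m (t + 1)) := by
  rw [h.val_eq, sum_add_distrib, sum_add_distrib, add_comm]
  congr 1
  have h1 := sum_range_succ (fun t => (digitBlock p (m t) (l t) x : ℤ) * (p : ℤ) ^ m t) n
  rw [sum_range_succ', hx, h.m_last, digitBlock_last] at h1
  simpa using h1.symm

end PerfectCode

/-! ### Digit tilings lie in families (b) and (c). -/

namespace PerfectCode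

open Finset

variable {p q k n r j : ℕ} {m l : ℕ → ℕ} {σ : ℕ → Prop} {A B : Set (ZMod (p ^ k) × ZMod q)}

/-- Needed because in family (b) the single integer `α_{i_0,…,i_r}` serves both as a coefficient
modulo `p^k` and as the `ℤ/q`-coordinate. -/
theorem exists_int_idempotent (hp : p.Prime) (hq : q.Prime) (hpq : p ≠ q) (k : ℕ) :
    ∃ e : ℤ, (p : ℤ) ^ k ∣ e - 1 ∧ (q : ℤ) ∣ e := by
  have hcop : IsCoprime ((p : ℤ) ^ k) (q : ℤ) :=
    IsCoprime.pow_left (Nat.isCoprime_iff_coprime.2 ((Nat.coprime_primes hp hq).2 hpq))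
  obtain ⟨x, y, hxy⟩ := hcop
  exact ⟨y * q, ⟨-x, by linear_combination hxy⟩, dvd_mul_left _ _⟩

/-- Here `B` is `S₀`. The first `l t` digits of each block are the indices `i_t`; the remaining
digits are functions of the indices so far, and `α` records these functions. -/
theorem subset_setB (hp : p.Prime) (hq : q.Prime) (hpq : p ≠ q) (h : Admissible k n r m l)
    (hT : IsDigitTiling p k q σ j A B)
    (hdet : ∀ t < n, ∀ s, m t + l t ≤ s → s < m (t + 1) → σ s)
    (hj : j ≤ m (r + 1)) (h0 : 0 ∈ B) :
    ∃ α, Normalized α ∧ B ⊆ setB p k q n r m l α := by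
  have : NeZero (p ^ k) := ⟨pow_ne_zero _ hp.ne_zero⟩
  have : NeZero q := ⟨hq.ne_zero⟩
  obtain ⟨e, he1, heq⟩ := exists_int_idempotent hp hq hpq k
  set i : ZMod (p ^ k) × ZMod q → ℕ → ℕ := fun b t => digitBlock p (m t) (l t) b.1 with hi
  have agree : ∀ b ∈ B, ∀ b' ∈ B, ∀ T ≤ n, (∀ u < T, i b u = i b' u) →
      (p : ZMod (p ^ k)) ^ m T ∣ b.1 - b'.1 := by
    intro b hb b' hb' T
    induction T with
    | zero => intro _ _; rw [h.m_zero, pow_zero]; exact one_dvd _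
    | succ T ih =>
      intro hTn hu
      have hle := h.add_le (t := T) hTn
      have hk := h.le_k hTn
      exact hT.right_block hle hk (hdet T hTn) hb hb'
        (pow_add_dvd_sub (hle.trans hk) (ih (by omega) fun u hu' => hu u (by omega))
          (hu T (by omega)))
  -- Congruent to the digit block modulo `p^k` and, for `t = r`, to the second coordinate modulo
  -- `q`.
  set val : ℕ → ZMod (p ^ k) × ZMod q → ℤ := fun t b =>
    (digitBlock p (m t + l t) (m (t + 1) - m t - l t) b.1 : ℤ) * e +
      (if t = r then (b.2.val : ℤ) else 0) * (1 - e) with hval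
  have hwd : ∀ b ∈ B, ∀ b' ∈ B, ∀ t < n, pre (i b) (t + 1) = pre (i b') (t + 1) →
      val t b = val t b' := by
    intro b hb b' hb' t ht hpre
    have hd := agree b hb b' hb' (t + 1) ht (pre_eq_iff.1 hpre)
    simp only [hval]
    have hle := h.add_le ht
    rw [digitBlock_eq_of_dvd (v := m (t + 1)) (by omega) (h.le_k ht) hd]
    split_ifs with htr
    · subst htr
      rw [hT.snd_eq b hb b' hb' ((pow_dvd_pow _ hj).trans hd)]
    · rfl
  obtain ⟨α, hα, hαval⟩ := exists_normalized
    (X := {x : (ZMod (p ^ k) × ZMod q) × ℕ // x.1 ∈ B ∧ x.2 < n})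
    (fun x => pre (i x.1.1) (x.1.2 + 1)) (fun x => val x.1.2 x.1.1)
    (by
      rintro ⟨⟨b, t⟩, hb, ht⟩ ⟨⟨b', t'⟩, hb', ht'⟩ heq
      have hlen := congrArg List.length heq
      simp only [length_pre, add_left_inj] at hlen
      subst hlen
      exact hwd b hb b' hb' t ht heq)
    (by
      rintro ⟨⟨b, t⟩, hb, ht⟩ hz
      have : val t b = val t 0 := hwd b hb 0 h0 t ht (by
        rw [pre_eq_iff]
        intro u hu
        rw [hz (i b u) (by simpa [pre] using ⟨u, by omega, rfl⟩)]
        simp [hi])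
      simpa [hval] using this)
  refine ⟨α, hα, fun b hb => ⟨i b, fun t _ => digitBlock_lt hp _ _ _, ?_⟩⟩
  have hαt : ∀ t < n, α (pre (i b) (t + 1)) = val t b := fun t ht => hαval ⟨(b, t), hb, ht⟩
  refine (eq_elt b).trans (elt_eq_iff.2 ⟨?_, ?_⟩)
  · rw [h.val_eq b.1, ← sum_sub_distrib]
    refine dvd_sum fun t ht => ?_
    rw [hαt t (mem_range.1 ht)]
    obtain ⟨f, hf⟩ := he1
    exact ⟨-f * (digitBlock p (m t + l t) (m (t + 1) - m t - l t) b.1 -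
      (if t = r then (b.2.val : ℤ) else 0)) * (p : ℤ) ^ (m t + l t), by
        simp only [hval, hi]
        linear_combination (-(digitBlock p (m t + l t) (m (t + 1) - m t - l t) b.1 -
          (if t = r then (b.2.val : ℤ) else 0)) * (p : ℤ) ^ (m t + l t)) * hf⟩
  · rw [hαt r h.r_lt]
    obtain ⟨f, rfl⟩ := heq
    exact ⟨f * (b.2.val - digitBlock p (m r + l r) (m (r + 1) - m r - l r) b.1), by
      simp only [hval, if_true]; ring⟩

/-- Here `A` is `C`. Its digits at the start of block `t + 1` are determined by what precedes them,
so they become the coefficient of `p ^ m (t + 1)` indexed by `i_0, …, i_t`, followed by `j` once the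
`ℤ/q`-coordinate has been passed. -/
theorem subset_codeB (hp : p.Prime) (hq : q.Prime) (h : Admissible k n r m l)
    (hT : IsDigitTiling p k q σ j A B)
    (hfree : ∀ t < n, ∀ s, m t ≤ s → s < m t + l t → ¬ σ s)
    (hj : m r + l r ≤ j) (h0 : 0 ∈ A) :
    ∃ β, Normalized β ∧ A ⊆ codeB p k q n r m l β := by
  have : NeZero (p ^ k) := ⟨pow_ne_zero _ hp.ne_zero⟩
  have : NeZero q := ⟨hq.ne_zero⟩
  have hrn := h.r_lt
  set i : ZMod (p ^ k) × ZMod q → ℕ → ℕ := fun a t =>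
    digitBlock p (m t + l t) (m (t + 1) - m t - l t) a.1 with hi
  have hqj : ∀ T < n, ∀ a a' : ZMod (p ^ k) × ZMod q, (r < T → a.2 = a'.2) →
      (j < m T + l T → a.2 = a'.2) := by
    intro T hTn a a' hrT hlt
    rcases lt_or_ge r T with hrT' | hrT'
    · exact hrT hrT'
    · rcases hrT'.eq_or_lt with rfl | hlt'
      · omega
      · have h1 := h.add_le hTn
        have h2 := h.le_last (s := T + 1) (t := r) hlt' hrn.le
        omega
  have agree : ∀ a ∈ A, ∀ a' ∈ A, ∀ T ≤ n, (∀ u < T, i a u = i a' u) →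
      (r < T → a.2 = a'.2) → (p : ZMod (p ^ k)) ^ m T ∣ a.1 - a'.1 := by
    intro a ha a' ha' T
    induction T with
    | zero => intro _ _ _; rw [h.m_zero, pow_zero]; exact one_dvd _
    | succ T ih =>
      intro hTn hu hrT
      have hle := h.add_le (t := T) hTn
      have hk := h.le_k hTn
      have hrT' : r < T → a.2 = a'.2 := fun h => hrT (by omega)
      have h1 := hT.left_block (Nat.le_add_right (m T) (l T)) (hle.trans hk) (hfree T hTn) ha ha'
        (hqj T hTn a a' hrT') (ih (by omega) (fun u hu' => hu u (by omega)) hrT')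
      have h2 := pow_add_dvd_sub (c := m (T + 1) - m T - l T) (by omega) h1 (hu T (by omega))
      rwa [show m T + l T + (m (T + 1) - m T - l T) = m (T + 1) by omega] at h2
  -- Lengths are `T` for `T ≤ r` and `T + 1` beyond, so the length of a key determines `T` and one
  -- family `β` serves all positions.
  set key : ZMod (p ^ k) × ZMod q → ℕ → List ℕ := fun a T =>
    if T ≤ r then pre (i a) T else pre (i a) T ++ [a.2.val] with hkey
  set val : ℕ → ZMod (p ^ k) × ZMod q → ℤ := fun T a =>
    (digitBlock p (m T) (l T) a.1 : ℤ) with hval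
  have hwd : ∀ a ∈ A, ∀ a' ∈ A, ∀ T ≤ n, key a T = key a' T → val T a = val T a' := by
    intro a ha a' ha' T hTn hpre
    have hpre' : pre (i a) T = pre (i a') T ∧ (r < T → a.2 = a'.2) := by
      simp only [hkey] at hpre
      split_ifs at hpre with hTr
      · exact ⟨hpre, fun h => by omega⟩
      · obtain ⟨h1, h2⟩ := List.append_inj hpre (by simp)
        exact ⟨h1, fun _ => ZMod.val_injective q (by simpa using h2)⟩
    have hd := agree a ha a' ha' T hTn (pre_eq_iff.1 hpre'.1) hpre'.2
    simp only [hval]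
    rcases hTn.eq_or_lt with rfl | hTn
    · rw [h.m_last, digitBlock_last, digitBlock_last]
    · have hle := h.add_le hTn
      have hk := h.le_k hTn
      rw [digitBlock_eq_of_dvd rfl (hle.trans hk) (hT.left_block (Nat.le_add_right (m T) (l T))
        (hle.trans hk) (hfree T hTn) ha ha' (hqj T hTn a a' hpre'.2) hd)]
  obtain ⟨β, hβ, hβval⟩ := exists_normalized
    (X := {x : (ZMod (p ^ k) × ZMod q) × ℕ // x.1 ∈ A ∧ x.2 ≤ n})
    (fun x => key x.1.1 x.1.2) (fun x => val x.1.2 x.1.1)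
    (by
      rintro ⟨⟨a, T⟩, ha, hTn⟩ ⟨⟨a', T'⟩, ha', hTn'⟩ heq
      have hlen := congrArg List.length heq
      have hTT : T = T' := by
        simp only [hkey] at hlen
        split_ifs at hlen <;> simp only [length_pre, List.length_append, List.length_singleton]
          at hlen <;> omega
      subst hTT
      exact hwd a ha a' ha' T hTn heq)
    (by
      rintro ⟨⟨a, T⟩, ha, hTn⟩ hz
      have : val T a = val T 0 := hwd a ha 0 h0 T hTn (by
        have hz' : ∀ u < T, i a u = 0 := by
          intro u hu
          refine hz _ ?_
          simp only [hkey]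
          split_ifs <;> simp [pre] <;> [skip; left] <;> exact ⟨u, hu, rfl⟩
        have hpz : pre (i a) T = pre (i 0) T := by
          rw [pre_eq_iff]
          intro u hu
          rw [hz' u hu]
          simp [hi]
        simp only [hkey] at hz ⊢
        rw [hpz]
        split_ifs with hTr
        · rfl
        · rw [if_neg hTr] at hz
          rw [hz a.2.val (by simp)]
          simp)
      simpa [hval] using this)
  have hβt : ∀ a ∈ A, ∀ T ≤ n, β (key a T) = val T a := fun a ha T hTn => hβval ⟨(a, T), ha, hTn⟩
  refine ⟨β, hβ, fun a ha => ⟨i a, a.2.val, fun t _ => digitBlock_lt hp _ _ _, ZMod.val_lt _, ?_⟩⟩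
  -- The key at `T = 0` is the empty tuple, where normalization forces the value `0`.
  have hfirst : digitBlock p (m 0) (l 0) a.1 = 0 := by
    have h1 := hβt a ha 0 (Nat.zero_le _)
    simp only [hkey, if_pos (Nat.zero_le r), hval] at h1
    rw [hβ _ (by simp [pre])] at h1
    exact_mod_cast h1.symm
  rw [add_assoc, sum_range_add_sum_Ico _ _ hrn.le, ← sum_add_distrib]
  refine (eq_elt a).trans ?_
  rw [h.val_eq' a.1 hfirst]
  congr 1
  refine sum_congr rfl fun t ht => ?_
  have h1 := hβt a ha (t + 1) (mem_range.1 ht)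
  simp only [hkey, hval] at h1
  rw [← h1]
  congr 1
  by_cases htr : t < r
  · rw [if_pos htr, if_pos (by omega)]
  · rw [if_neg htr, if_neg (by omega)]

end PerfectCode

namespace PerfectCode

open Finset

variable {p q k n r j : ℕ} {m l : ℕ → ℕ} {σ : ℕ → Prop} {A B : Set (ZMod (p ^ k) × ZMod q)}

theorem subset_setC (hp : p.Prime) (hq : q.Prime) (h : Admissible k n r m l)
    (hT : IsDigitTiling p k q σ j A B)
    (hdet : ∀ t < n, ∀ s, m t + l t ≤ s → s < m (t + 1) → ¬ σ s)
    (hj : m r ≤ j) (hl : l r = 0) (h0 : 0 ∈ A) :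
    ∃ α, Normalized α ∧ A ⊆ setC p k q n r m l α := by
  have : NeZero (p ^ k) := ⟨pow_ne_zero _ hp.ne_zero⟩
  have : NeZero q := ⟨hq.ne_zero⟩
  set i : ZMod (p ^ k) × ZMod q → ℕ → ℕ := fun a t =>
    if t = r then a.2.val else digitBlock p (m t) (l t) a.1 with hi
  have agree : ∀ a ∈ A, ∀ a' ∈ A, ∀ T ≤ n, (∀ u < T, i a u = i a' u) →
      (p : ZMod (p ^ k)) ^ m T ∣ a.1 - a'.1 := by
    intro a ha a' ha' T
    induction T with
    | zero => intro _ _; rw [h.m_zero, pow_zero]; exact one_dvd _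
    | succ T ih =>
      intro hTn hu
      have hle := h.add_le (t := T) hTn
      have hk := h.le_k hTn
      have hjT : j < m (T + 1) → a.2 = a'.2 := by
        intro hlt
        have hrT : r < T + 1 := by
          by_contra hc
          have := h.le_last (s := T + 1) (t := r) (by omega) h.r_lt.le
          omega
        have := hu r hrT
        simp only [hi, if_true] at this
        exact ZMod.val_injective q this
      have hdig : digitBlock p (m T) (l T) a.1 = digitBlock p (m T) (l T) a'.1 := by
        have := hu T (by omega)
        simp only [hi] at this
        split_ifs at this with hTr
        · rw [hTr, hl, digitBlock_zero_length, digitBlock_zero_length]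
        · exact this
      exact hT.left_block hle hk (hdet T hTn) ha ha' hjT
        (pow_add_dvd_sub (hle.trans hk) (ih (by omega) fun u hu' => hu u (by omega)) hdig)
  set val : ℕ → ZMod (p ^ k) × ZMod q → ℤ := fun t a =>
    (digitBlock p (m t + l t) (m (t + 1) - m t - l t) a.1 : ℤ) with hval
  have hwd : ∀ a ∈ A, ∀ a' ∈ A, ∀ t < n, pre (i a) (t + 1) = pre (i a') (t + 1) →
      val t a = val t a' := by
    intro a ha a' ha' t ht hpre
    have hd := agree a ha a' ha' (t + 1) ht (pre_eq_iff.1 hpre)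
    have hle := h.add_le ht
    simp only [hval]
    rw [digitBlock_eq_of_dvd (v := m (t + 1)) (by omega) (h.le_k ht) hd]
  obtain ⟨α, hα, hαval⟩ := exists_normalized
    (X := {x : (ZMod (p ^ k) × ZMod q) × ℕ // x.1 ∈ A ∧ x.2 < n})
    (fun x => pre (i x.1.1) (x.1.2 + 1)) (fun x => val x.1.2 x.1.1)
    (by
      rintro ⟨⟨a, t⟩, ha, ht⟩ ⟨⟨a', t'⟩, ha', ht'⟩ heq
      have hlen := congrArg List.length heq
      simp only [length_pre, add_left_inj] at hlen
      subst hlen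
      exact hwd a ha a' ha' t ht heq)
    (by
      rintro ⟨⟨a, t⟩, ha, ht⟩ hz
      have : val t a = val t 0 := hwd a ha 0 h0 t ht (by
        rw [pre_eq_iff]
        intro u hu
        rw [hz (i a u) (by simpa [pre] using ⟨u, by omega, rfl⟩)]
        simp [hi])
      simpa [hval] using this)
  refine ⟨α, hα, fun a ha => ⟨i a, fun t _ htr => ?_, ?_, ?_⟩⟩
  · simp only [hi, if_neg htr]
    exact digitBlock_lt hp _ _ _
  · simp only [hi, if_true]
    exact ZMod.val_lt _
  · rw [sum_range_erase, ← sum_add_distrib]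
    refine (eq_elt a).trans ?_
    rw [h.val_eq a.1]
    congr 1
    · refine sum_congr rfl fun t ht => ?_
      have h1 : α (pre (i a) (t + 1)) = val t a := hαval ⟨(a, t), ha, mem_range.1 ht⟩
      rw [h1]
      congr 1
      simp only [hi]
      split_ifs with htr
      · rw [htr, hl, digitBlock_zero_length]
        simp
      · rfl
    · simp [hi]

/-- Since `l r = 0`, the start of block `r` is empty and `β_{i_0,…,i_{r-1}}` is not needed as a
digit; it stores the second coordinate. -/
theorem subset_codeC (hp : p.Prime) (hq : q.Prime) (h : Admissible k n r m l)
    (hT : IsDigitTiling p k q σ j A B)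
    (hfree : ∀ t < n, ∀ s, m t ≤ s → s < m t + l t → σ s)
    (hj : j ≤ m r) (hl : l r = 0) (h0 : 0 ∈ B) :
    ∃ β, Normalized β ∧ B ⊆ codeC p k q n r m l β := by
  have : NeZero (p ^ k) := ⟨pow_ne_zero _ hp.ne_zero⟩
  have : NeZero q := ⟨hq.ne_zero⟩
  have hrn := h.r_lt
  set i : ZMod (p ^ k) × ZMod q → ℕ → ℕ := fun b t =>
    digitBlock p (m t + l t) (m (t + 1) - m t - l t) b.1 with hi
  have agree : ∀ b ∈ B, ∀ b' ∈ B, ∀ T ≤ n, (∀ u < T, i b u = i b' u) →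
      (p : ZMod (p ^ k)) ^ m T ∣ b.1 - b'.1 := by
    intro b hb b' hb' T
    induction T with
    | zero => intro _ _; rw [h.m_zero, pow_zero]; exact one_dvd _
    | succ T ih =>
      intro hTn hu
      have hle := h.add_le (t := T) hTn
      have hk := h.le_k hTn
      have h1 := hT.right_block (Nat.le_add_right (m T) (l T)) (hle.trans hk) (hfree T hTn) hb hb'
        (ih (by omega) (fun u hu' => hu u (by omega)))
      have h2 := pow_add_dvd_sub (c := m (T + 1) - m T - l T) (by omega) h1 (hu T (by omega))
      rwa [show m T + l T + (m (T + 1) - m T - l T) = m (T + 1) by omega] at h2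
  set val : ℕ → ZMod (p ^ k) × ZMod q → ℤ := fun T b =>
    if T = r then (b.2.val : ℤ) else (digitBlock p (m T) (l T) b.1 : ℤ) with hval
  have hwd : ∀ b ∈ B, ∀ b' ∈ B, ∀ T ≤ n, pre (i b) T = pre (i b') T → val T b = val T b' := by
    intro b hb b' hb' T hTn hpre
    have hd := agree b hb b' hb' T hTn (pre_eq_iff.1 hpre)
    simp only [hval]
    split_ifs with hTr
    · subst hTr
      rw [hT.snd_eq b hb b' hb' ((pow_dvd_pow _ hj).trans hd)]
    rcases hTn.eq_or_lt with rfl | hTn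
    · rw [h.m_last, digitBlock_last, digitBlock_last]
    · have hle := h.add_le hTn
      have hk := h.le_k hTn
      rw [digitBlock_eq_of_dvd rfl (hle.trans hk) (hT.right_block (Nat.le_add_right (m T) (l T))
        (hle.trans hk) (hfree T hTn) hb hb' hd)]
  obtain ⟨β, hβ, hβval⟩ := exists_normalized
    (X := {x : (ZMod (p ^ k) × ZMod q) × ℕ // x.1 ∈ B ∧ x.2 ≤ n})
    (fun x => pre (i x.1.1) x.1.2) (fun x => val x.1.2 x.1.1)
    (by
      rintro ⟨⟨b, T⟩, hb, hTn⟩ ⟨⟨b', T'⟩, hb', hTn'⟩ heq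
      have hlen := congrArg List.length heq
      simp only [length_pre] at hlen
      subst hlen
      exact hwd b hb b' hb' T hTn heq)
    (by
      rintro ⟨⟨b, T⟩, hb, hTn⟩ hz
      have : val T b = val T 0 := hwd b hb 0 h0 T hTn (by
        rw [pre_eq_iff]
        intro u hu
        rw [hz (i b u) (by simpa [pre] using ⟨u, by omega, rfl⟩)]
        simp [hi])
      simpa [hval] using this)
  have hβt : ∀ b ∈ B, ∀ T ≤ n, β (pre (i b) T) = val T b := fun b hb T hTn =>
    hβval ⟨(b, T), hb, hTn⟩
  refine ⟨β, hβ, fun b hb => ⟨i b, fun t _ => digitBlock_lt hp _ _ _, ?_⟩⟩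
  have hfirst : digitBlock p (m 0) (l 0) b.1 = 0 := by
    rcases Nat.eq_zero_or_pos r with rfl | hr
    · rw [hl, digitBlock_zero_length]
    · have h1 := hβt b hb 0 (Nat.zero_le _)
      simp only [hval, if_neg hr.ne] at h1
      rw [hβ _ (by simp [pre])] at h1
      exact_mod_cast h1.symm
  rw [sum_filter, ← sum_add_distrib]
  refine (eq_elt b).trans ?_
  rw [h.val_eq' b.1 hfirst]
  congr 1
  · refine sum_congr rfl fun t ht => ?_
    rw [hβt b hb (t + 1) (mem_range.1 ht)]
    congr 1
    simp only [hval]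
    by_cases htr : t + 1 = r
    · rw [htr, hl, digitBlock_zero_length]
      simp
    · simp [htr]
  · rw [hβt b hb r hrn.le]
    simp [hval]

end PerfectCode

/-! ### Cutting the digit positions into blocks. -/

namespace PerfectCode

-- `P` marks the digits free in `S₀`; each such position opens a block with `l t = 1`. Letting `P`
-- hold from `k` on makes `nth P` total and gives `m n = k` for `n = count P k`. The index `r` is
-- that of the last marked position below `j`.
open Nat in
theorem exists_blocks_of_one_le {P : ℕ → Prop} {k j : ℕ} (hP : ∀ s, k ≤ s → P s) (h0 : P 0)
    (hj : 1 ≤ j) (hjk : j ≤ k) : ∃ (n r : ℕ) (m l : ℕ → ℕ), Admissible k n r m l ∧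
      m r < m (r + 1) ∧ m r + l r ≤ j ∧ j ≤ m (r + 1) ∧
      (∀ t < n, ∀ s, m t ≤ s → s < m t + l t → P s) ∧
      (∀ t < n, ∀ s, m t + l t ≤ s → s < m (t + 1) → ¬ P s) := by
  classical
  have hinf : {s | P s}.Infinite := Set.infinite_of_not_bddAbove fun ⟨b, hb⟩ => by
    have := hb (show max k (b + 1) ∈ {s | P s} from hP _ (le_max_left _ _))
    have := le_max_right k (b + 1)
    omega
  have hmono : StrictMono (nth P) := nth_strictMono hinf
  have hcj : 1 ≤ count P j := by
    rw [show 1 = count P 1 by simp [count_succ, h0]]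
    exact count_monotone P hj
  have hck : count P j ≤ count P k := count_monotone P hjk
  have hsucc : ∀ t, nth P t < nth P (t + 1) := fun t => hmono t.lt_succ_self
  have hr : count P j - 1 + 1 = count P j := by omega
  have hle : nth P (count P j - 1) < j := nth_lt_of_lt_count (by omega)
  refine ⟨count P k, count P j - 1, nth P, fun _ => 1, ⟨by omega, nth_zero_of_zero h0,
    nth_count (hP k le_rfl), fun t _ _ => hsucc t, (hsucc _).le, fun _ _ _ => le_rfl,
    fun t _ => by have := hsucc t; omega⟩, hsucc _, Nat.succ_le_of_lt hle, ?_, ?_, ?_⟩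
  · rw [hr]
    exact le_nth_count hinf j
  · intro t _ s h1 h2
    beta_reduce at h2
    rw [show s = nth P t by omega]
    exact nth_mem_of_infinite hinf t
  · intro t _ s h1 h2 hs
    beta_reduce at h1
    rw [← nth_count hs] at h1 h2
    have h3 := hmono.lt_iff_lt.1 h2
    have h4 := hmono.lt_iff_lt.1 (show nth P t < nth P (count P s) by omega)
    omega

-- The same cutting with one extra cut at `j`, opening a block with `l r = 0`. It may coincide with
-- the next cut, whence only `m r ≤ m (r + 1)`.
open Nat in
theorem exists_blocks_of_le {P : ℕ → Prop} {k j : ℕ} (hP : ∀ s, k ≤ s → P s) (h0 : 1 ≤ j → P 0)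
    (hjk : j ≤ k) : ∃ (n r : ℕ) (m l : ℕ → ℕ), Admissible k n r m l ∧ m r = j ∧ l r = 0 ∧
      (∀ t < n, ∀ s, m t ≤ s → s < m t + l t → P s) ∧
      (∀ t < n, ∀ s, m t + l t ≤ s → s < m (t + 1) → ¬ P s) := by
  classical
  have hinf : {s | P s}.Infinite := Set.infinite_of_not_bddAbove fun ⟨b, hb⟩ => by
    have := hb (show max k (b + 1) ∈ {s | P s} from hP _ (le_max_left _ _))
    have := le_max_right k (b + 1)
    omega
  have hmono : StrictMono (nth P) := nth_strictMono hinf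
  have hck : count P j ≤ count P k := count_monotone P hjk
  have hsucc : ∀ t, nth P t < nth P (t + 1) := fun t => hmono t.lt_succ_self
  have hjr : j ≤ nth P (count P j) := le_nth_count hinf j
  set r := count P j with hr
  set m : ℕ → ℕ := fun t => if t < r then nth P t else if t = r then j else nth P (t - 1) with hm
  have hm1 : ∀ t < r, m t = nth P t := fun t ht => by simp [hm, ht]
  have hm2 : m r = j := by simp [hm]
  have hm3 : ∀ t, r ≤ t → m (t + 1) = nth P t := fun t ht => by
    simp only [hm]
    rw [if_neg (by omega), if_neg (by omega), Nat.add_sub_cancel]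
  have hlt : ∀ t, t ≠ r → m t < m (t + 1) := by
    intro t ht
    rcases lt_or_gt_of_ne ht with ht | ht
    · rw [hm1 t ht]
      rcases (show t + 1 ≤ r from ht).eq_or_lt with h | h
      · rw [h, hm2]
        exact nth_lt_of_lt_count ht
      · rw [hm1 _ h]
        exact hsucc t
    · obtain ⟨t, rfl⟩ := Nat.exists_eq_succ_of_ne_zero (by omega : t ≠ 0)
      rw [succ_eq_add_one, hm3 t (by omega), hm3 (t + 1) (by omega)]
      exact hsucc t
  have hl : ∀ t, t ≠ r → (if t = r then 0 else 1) = 1 := fun t ht => if_neg ht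
  refine ⟨count P k + 1, r, m, fun t => if t = r then 0 else 1, ⟨by omega, ?_, ?_,
    fun t _ => hlt t, by rw [hm2, hm3 r le_rfl]; exact hjr, fun t _ ht => (hl t ht).ge,
    fun t _ => ?_⟩, hm2, if_pos rfl, ?_, ?_⟩
  · rcases Nat.eq_zero_or_pos r with h | h
    · have hj0 : j = 0 := by
        by_contra hj
        have : count P 1 ≤ count P j := count_monotone P (by omega)
        have h1 : count P 1 = 1 := by simp [count_succ, h0 (by omega)]
        omega
      rw [← h, hm2, hj0]
      exact hj0 ▸ h.symm
    · rw [hm1 0 h]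
      refine nth_zero_of_zero (h0 ?_)
      by_contra hj
      rw [hr, show j = 0 by omega, count_zero] at h
      omega
  · rw [hm3 _ hck]
    exact nth_count (hP k le_rfl)
  · split_ifs with ht
    · omega
    · have := hlt t ht
      omega
  · intro t _ s h1 h2
    beta_reduce at h2
    split_ifs at h2 with ht
    · omega
    · rw [show s = m t by omega]
      rcases lt_or_gt_of_ne ht with ht | ht
      · rw [hm1 t ht]
        exact nth_mem_of_infinite hinf t
      · obtain ⟨t, rfl⟩ := Nat.exists_eq_succ_of_ne_zero (by omega : t ≠ 0)
        rw [succ_eq_add_one, hm3 t (by omega)]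
        exact nth_mem_of_infinite hinf t
  · intro t _ s h1 h2 hs
    beta_reduce at h1
    rcases lt_trichotomy t r with ht | ht | ht
    · rw [hl t ht.ne, hm1 t ht] at h1
      rw [← nth_count hs] at h1
      have h4 := hmono.lt_iff_lt.1 (show nth P t < nth P (count P s) by omega)
      rcases (show t + 1 ≤ r from ht).eq_or_lt with h | h
      · rw [h, hm2] at h2
        have := count_strict_mono hs h2
        omega
      · rw [hm1 _ h, ← nth_count hs] at h2
        have h3 := hmono.lt_iff_lt.1 h2
        omega
    · rw [ht, hm2] at h1
      rw [ht, hm3 r le_rfl, ← nth_count hs] at h2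
      have h3 := hmono.lt_iff_lt.1 h2
      have : count P j ≤ count P s := count_monotone P (by omega)
      omega
    · obtain ⟨t, rfl⟩ := Nat.exists_eq_succ_of_ne_zero (by omega : t ≠ 0)
      rw [hl _ ht.ne', succ_eq_add_one, hm3 t (by omega), ← nth_count hs] at h1
      rw [succ_eq_add_one, hm3 (t + 1) (by omega), ← nth_count hs] at h2
      have h3 := hmono.lt_iff_lt.1 h2
      have h4 := hmono.lt_iff_lt.1 (show nth P t < nth P (count P s) by omega)
      omega

end PerfectCode

/-! ### Perfect codes as tilings, and the classification. -/

section Main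

open AddSubgroup

theorem isPerfectCode_cayleyDigraph_iff {G : Type*} [AddCommGroup G] (S C : Set G) :
    (cayleyDigraph S).IsPerfectCode C ↔ IsComplement (S ∪ {0}) C := by
  have hmem : ∀ u v : G, (u = v ∨ (cayleyDigraph S).Adj u v) ↔ v - u ∈ S ∪ {0} := by
    intro u v
    simp only [cayleyDigraph, Set.union_singleton, Set.mem_insert_iff, sub_eq_zero]
    rw [eq_comm]
  constructor
  · intro h
    refine IsComplement.of_exists_of_inj (fun v => ?_) ?_
    · obtain ⟨u, ⟨hu, huv⟩, -⟩ := h v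
      exact ⟨v - u, (hmem u v).1 huv, u, hu, sub_add_cancel _ _⟩
    · intro s hs s' hs' c hc c' hc' heq
      have := (h (s + c)).unique ⟨hc, (hmem _ _).2 (by simpa using hs)⟩
        ⟨hc', (hmem _ _).2 (by rw [heq]; simpa using hs')⟩
      subst this
      exact ⟨add_right_cancel heq, rfl⟩
  · intro h v
    obtain ⟨s, hs, c, hc, rfl⟩ := h.exists_add v
    refine ⟨c, ⟨hc, (hmem _ _).2 (by simpa using hs)⟩, fun c' ⟨hc', h'⟩ => ?_⟩
    exact (h.add_inj ((hmem _ _).1 h') hs hc' hc (by abel)).2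

/-- Decompose `x ∈ A'` as `a + b` in the small tiling; in the large one `x + 0` is the same element,
so `x = a`. -/
theorem AddSubgroup.IsComplement.eq_of_subset {G : Type*} [AddCommGroup G] {A B A' B' : Set G}
    (h : IsComplement A B) (h' : IsComplement A' B') (hA : A ⊆ A') (hB : B ⊆ B')
    (hA0 : 0 ∈ A) (hB0 : 0 ∈ B) : A = A' ∧ B = B' := by
  refine ⟨hA.antisymm fun x hx => ?_, hB.antisymm fun x hx => ?_⟩
  · obtain ⟨a, ha, b, hb, hab⟩ := h.exists_add x
    rw [← (h'.add_inj (hA ha) hx (hB hb) (hB hB0) (by rw [hab, add_zero])).1]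
    exact ha
  · obtain ⟨a, ha, b, hb, hab⟩ := h.exists_add x
    rw [← (h'.add_inj (hA ha) (hA hA0) (hB hb) hx (by rw [hab, zero_add])).2]
    exact hb

variable {p q k : ℕ}

/-- A generating set of `ℤ/p^k × ℤ/q` contains an element whose first coordinate is not divisible
by `p`. -/
theorem exists_not_dvd_fst_of_closure_eq_top (hp : p.Prime) (hk : 1 ≤ k)
    {S : Set (ZMod (p ^ k) × ZMod q)} (hS : AddSubgroup.closure S = ⊤) :
    ∃ s ∈ S, ¬ (p : ZMod (p ^ k)) ^ 1 ∣ s.1 := by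
  by_contra! hdvd
  have hle : AddSubgroup.closure S ≤ ((Ideal.span {(p : ZMod (p ^ k)) ^ 1}).toAddSubgroup).comap
      (AddMonoidHom.fst (ZMod (p ^ k)) (ZMod q)) := by
    rw [closure_le]
    exact fun s hs => Ideal.mem_span_singleton.2 (hdvd s hs)
  have h1 := hle (hS ▸ mem_top ((1, 0) : ZMod (p ^ k) × ZMod q))
  have h2 : (p : ZMod (p ^ k)) ^ 1 ∣ ((1 : ℤ) : ZMod (p ^ k)) := by
    simpa using Ideal.mem_span_singleton.1 h1
  rw [ZMod.pow_dvd_intCast_iff hk, pow_one] at h2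
  exact hp.one_lt.ne' (by exact_mod_cast Int.eq_one_of_dvd_one (by positivity) h2)

theorem exists_snd_ne_zero_of_closure_eq_top (hq : q.Prime)
    {S : Set (ZMod (p ^ k) × ZMod q)} (hS : AddSubgroup.closure S = ⊤) : ∃ s ∈ S, s.2 ≠ 0 := by
  by_contra! h0
  have hle : AddSubgroup.closure S ≤ (AddMonoidHom.snd (ZMod (p ^ k)) (ZMod q)).ker := by
    rw [closure_le]
    exact fun s hs => h0 s hs
  have h1 := hle (hS ▸ mem_top ((0, 1) : ZMod (p ^ k) × ZMod q))
  have : Fact (1 < q) := ⟨hq.one_lt⟩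
  exact one_ne_zero (α := ZMod q) h1

end Main

theorem mainTheorem6 (p q k : ℕ) (hp : p.Prime) (hq : q.Prime) (hpq : p ≠ q) (hk : 1 ≤ k)
    (S C : Set (ZMod (p ^ k) × ZMod q))
    (hS : S ⊂ {x | x ≠ 0}) (hgen : AddSubgroup.closure S = ⊤) (hC : 0 ∈ C) :
    (cayleyDigraph S).IsPerfectCode C ↔
      ∃ (n r : ℕ) (m l : ℕ → ℕ) (α β : List ℕ → ℤ),
        PerfectCode.Admissible k n r m l ∧
        PerfectCode.Normalized α ∧ PerfectCode.Normalized β ∧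
        ((m r < m (r + 1) ∧ m r + l r = m (r + 1) ∧
            S ∪ {0} = PerfectCode.setA p k q n r m l α ∧
            C = PerfectCode.codeA p k q n r m l β) ∨
          (m r < m (r + 1) ∧
            S ∪ {0} = PerfectCode.setB p k q n r m l α ∧
            C = PerfectCode.codeB p k q n r m l β) ∨
          (l r = 0 ∧
            S ∪ {0} = PerfectCode.setC p k q n r m l α ∧
            C = PerfectCode.codeC p k q n r m l β) ∨
          (m r < m (r + 1) ∧
            S ∪ {0} = PerfectCode.setD p k q n r m l α ∧
            C = PerfectCode.codeD p k q n r m l β)) := by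
  rw [isPerfectCode_cayleyDigraph_iff]
  constructor
  · intro h
    have hS0 : (0 : ZMod (p ^ k) × ZMod q) ∈ S ∪ {0} := Or.inr rfl
    obtain ⟨s, hs, hsp⟩ := exists_not_dvd_fst_of_closure_eq_top hp hk hgen
    have hs' : s ∈ S ∪ {0} := Or.inl hs
    rcases h.exists_isDigitTiling hp hq hpq with ⟨σ, j, hT⟩ | ⟨σ, j, hT⟩
    -- If the `ℤ/q`-coordinate comes after digit `0`, that digit cannot be constant on `S₀`, because
    -- `S` generates `G`.
    · have h0 : 1 ≤ j → k ≤ 0 ∨ σ 0 := by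
        intro hj
        by_contra! h0
        have := hT.left 0 hk h0.2 s hs' 0 hS0 (by simp) (by omega)
        exact hsp (by simpa using this)
      obtain ⟨n, r, m, l, hA, hmj, hl, hfree, hdet⟩ := PerfectCode.exists_blocks_of_le
        (P := fun s => k ≤ s ∨ σ s) (fun s hs => Or.inl hs) h0 hT.le
      have hfree' : ∀ t < n, ∀ s, m t ≤ s → s < m t + l t → σ s := fun t ht s h1 h2 =>
        (hfree t ht s h1 h2).resolve_left (by
          have := hA.add_le ht
          have := hA.le_k (t := t + 1) ht
          omega)
      obtain ⟨α, hα, hSα⟩ := PerfectCode.subset_setC hp hq hA hT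
        (fun t ht s h1 h2 h3 => hdet t ht s h1 h2 (Or.inr h3)) hmj.le hl hS0
      obtain ⟨β, hβ, hCβ⟩ := PerfectCode.subset_codeC hp hq hA hT hfree' hmj.ge hl hC
      exact ⟨n, r, m, l, α, β, hA, hα, hβ, Or.inr (Or.inr (Or.inl ⟨hl,
        h.eq_of_subset (PerfectCode.isComplement_setC_codeC hp hq hA hl α β) hSα hCβ hS0 hC⟩))⟩
    -- For `j = 0` the second coordinate would be constant on `S₀`, contradicting generation.
    · have hj : 1 ≤ j := by
        by_contra hj
        obtain ⟨s, hs, hs0⟩ := exists_snd_ne_zero_of_closure_eq_top hq hgen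
        exact hs0 (hT.snd_eq s (Or.inl hs) 0 hS0 (by simp [show j = 0 by omega]))
      have h0 : ¬ σ 0 := by
        intro h0
        have := hT.right 0 hk h0 s hs' 0 hS0 (by simp)
        exact hsp (by simpa using this)
      obtain ⟨n, r, m, l, hA, hmr, hmj, hjm, hfree, hdet⟩ := PerfectCode.exists_blocks_of_one_le
        (P := fun s => k ≤ s ∨ ¬ σ s) (fun s hs => Or.inl hs) (Or.inr h0) hj hT.le
      have hfree' : ∀ t < n, ∀ s, m t ≤ s → s < m t + l t → ¬ σ s := fun t ht s h1 h2 =>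
        (hfree t ht s h1 h2).resolve_left (by
          have := hA.add_le ht
          have := hA.le_k (t := t + 1) ht
          omega)
      obtain ⟨α, hα, hSα⟩ := PerfectCode.subset_setB hp hq hpq hA hT
        (fun t ht s h1 h2 => not_not.1 fun h3 => hdet t ht s h1 h2 (Or.inr h3)) hjm hS0
      obtain ⟨β, hβ, hCβ⟩ := PerfectCode.subset_codeB hp hq hA hT hfree' hmj hC
      exact ⟨n, r, m, l, α, β, hA, hα, hβ, Or.inr (Or.inl ⟨hmr,
        h.eq_of_subset (PerfectCode.isComplement_setB_codeB hp hq hA α β) hSα hCβ hS0 hC⟩)⟩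
  · rintro ⟨n, r, m, l, α, β, hA, -, -, ⟨-, hr, h1, h2⟩ | ⟨-, h1, h2⟩ | ⟨hl, h1, h2⟩ | ⟨-, h1, h2⟩⟩
    · rw [h1, h2]
      exact PerfectCode.isComplement_setA_codeA hp hq hA hr α β
    · rw [h1, h2]
      exact PerfectCode.isComplement_setB_codeB hp hq hA α β
    · rw [h1, h2]
      exact PerfectCode.isComplement_setC_codeC hp hq hA hl α β
    · rw [h1, h2]
      exact PerfectCode.isComplement_setD_codeD hp hq hA α β
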